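/- Let $n\ge 1$ and $0\le m\le n$ be integers and let $\alpha=(\alpha_1,\dots,\alpha_k)$ be a composition of $m$, i.e. a tuple of $k=\ell(\alpha)$ positive integers with sum $m$ (the empty tuple if $m=0$). All partitions $\lambda$ below are integer partitions of $n$, $\ell(\lambda)$ is the number of parts of $\lambda$, and $\mathcal C_\lambda$ is the set of permutations of $[n]=\{1,\dots,n\}$ of cycle type $\lambda$. Let $\mathbf x=(x_1,x_2,\dots)$ be infinitely many variables, and let $p_\lambda(\mathbf x)$ and $m_\lambda(\mathbf x)$ be the power and monomial symmetric functions; $[p_\lambda(\mathbf x)]f(\mathbf x)$ is the coefficient of $p_\lambda$ in the expansion of the symmetric function $f$ (over $\mathbb Q$) in the basis of power symmetric functions. Let $\mathcal A_n^\alpha$ be the set of tuples $A=(A_1,\dots,A_k)$ of pairwise disjoint subsets of $[n]$ with $\#A_i=\alpha_i$ for all $i$. A permutation is $A$-separated if none of its cycles contains elements of more than one of the $A_i$. Let $\mathcal S_\lambda^\alpha$ be the set of pairs $(\pi,A)$ with $\pi\in\mathcal C_\lambda$ and $A\in\mathcal A_n^\alpha$ such that $\pi\circ(1,2,\dots,n)$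 is $A$-separated, and for such a pair let $u(\pi,A)$ be the number of cycles of $\pi\circ(1,2,\dots,n)$ (fixed points included) that contain no element of $A_1\cup\dots\cup A_k$. Put $$G_n^\alpha(\mathbf x,t):=\sum_{\lambda\vdash n}p_\lambda(\mathbf x)\sum_{(\pi,A)\in\mathcal S_\lambda^\alpha}t^{\,u(\pi,A)},\qquad \binom tr:=\frac{t(t-1)\cdots(t-r+1)}{r!}.$$ Then, as an identity of series in $\mathbf x$ with coefficients in $\mathbb Q[t]$, $$G_n^\alpha(\mathbf x,t+k)=\sum_{r=0}^{n-m}\binom tr\binom{n+k-1}{n-m-r}\sum_{\lambda\vdash n,\ \ell(\lambda)\le n-k-r+1}\frac{n\,(n-\ell(\lambda))!\,(n-k-r)!}{(n-k-r-\ell(\lambda)+1)!}\;m_\lambda(\mathbf x).$$ Moreover, for every partition $\lambda$ of $n$, $$\#\mathcal S_\lambda^\alpha=[p_\lambda(\mathbf x)]\,G_n^\alpha(\mathbf x,1),$$ and for every $A\in\mathcal A_n^\alpha$ the probability $\sigma_\lambda^\alpha$ that the product of a uniformly random permutation of cycle type $\lambda$ with an independent uniformly random $n$-cycle is $A$-separated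 is $$\sigma_\lambda^\alpha=\frac{\#\mathcal S_\lambda^\alpha}{\binom{n}{\alpha_1,\dots,\alpha_k,\,n-m}\,\#\mathcal C_\lambda},\qquad \binom{n}{\alpha_1,\dots,\alpha_k,\,n-m}=\frac{n!}{\alpha_1!\cdots\alpha_k!\,(n-m)!}$$ (in particular it depends on $A$ only through $\alpha$). In particular, $G_n^\alpha$ depends on $\alpha$ only through its size and length: $G_n^\beta=G_n^\alpha$ for every composition $\beta$ of $m$ with $k$ parts. -/

import Mathlib

open scoped Nat

namespace SeparationProb

noncomputable section

/-! ### Symmetric functions in the infinitely many variables `x_0, x_1, x_2, …` -/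

/-- The power series `p_j(x) = ∑_i x_i ^ j` (used for `j ≥ 1`): the coefficient of a monomial is `1`
if the monomial is `x_i ^ j` for some `i`, and `0` otherwise. -/
def psum (R : Type*) [CommRing R] (j : ℕ) : MvPowerSeries ℕ R :=
  open Classical in fun e => if ∃ i : ℕ, e = Finsupp.single i j then 1 else 0

/-- The power symmetric function `p_lam = ∏_i p_{lam_i}`. -/
def powerSum (R : Type*) [CommRing R] {n : ℕ} (lam : n.Partition) : MvPowerSeries ℕ R :=
  (lam.parts.map (psum R)).prod

/-- The monomial symmetric function `m_lam`: the sum of all monomials `x ^ e` such that the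
multiset of the positive exponents of `e` is the multiset of the parts of `lam`. -/
def monomialSym (R : Type*) [CommRing R] {n : ℕ} (lam : n.Partition) : MvPowerSeries ℕ R :=
  open Classical in fun e => if e.support.val.map e = lam.parts then 1 else 0

/-! #### The power symmetric functions are linearly independent over `ℚ` -/

lemma coeff_psum (j : ℕ) (e : ℕ →₀ ℕ) [Decidable (∃ i : ℕ, e = Finsupp.single i j)] :
    MvPowerSeries.coeff e (psum ℚ j) = if ∃ i : ℕ, e = Finsupp.single i j then 1 else 0 := by
  change psum ℚ j e = _
  unfold psum
  congr

lemma coeff_psum_nonneg (j : ℕ) (e : ℕ →₀ ℕ) : 0 ≤ MvPowerSeries.coeff e (psum ℚ j) := by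
  classical
  rw [coeff_psum]; split_ifs <;> norm_num

lemma coeff_prod_nonneg (s : Multiset ℕ) (e : ℕ →₀ ℕ) :
    0 ≤ MvPowerSeries.coeff e (s.map (psum ℚ)).prod := by
  classical
  induction s using Multiset.induction_on generalizing e with
  | empty =>
    simp only [Multiset.map_zero, Multiset.prod_zero, MvPowerSeries.coeff_one]
    split_ifs <;> norm_num
  | cons a s ih =>
    rw [Multiset.map_cons, Multiset.prod_cons, MvPowerSeries.coeff_mul]
    exact Finset.sum_nonneg fun p _ => mul_nonneg (coeff_psum_nonneg _ _) (ih _)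

lemma card_support_le (s : Multiset ℕ) (hs : ∀ a ∈ s, 0 < a) (e : ℕ →₀ ℕ)
    (h : MvPowerSeries.coeff e (s.map (psum ℚ)).prod ≠ 0) :
    e.support.card ≤ s.card ∧ (e.support.card = s.card → e.support.val.map e = s) := by
  classical
  induction s using Multiset.induction_on generalizing e with
  | empty =>
    simp only [Multiset.map_zero, Multiset.prod_zero, MvPowerSeries.coeff_one] at h
    have : e = 0 := by by_contra h0; simp [h0] at h
    subst this
    simp
  | cons a s ih =>
    rw [Multiset.map_cons, Multiset.prod_cons, MvPowerSeries.coeff_mul] at h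
    obtain ⟨⟨e1, e2⟩, hmem, hne⟩ := Finset.exists_ne_zero_of_sum_ne_zero h
    rw [Finset.HasAntidiagonal.mem_antidiagonal] at hmem
    simp only at hmem hne
    have h1 := left_ne_zero_of_mul hne
    have h2 := right_ne_zero_of_mul hne
    rw [coeff_psum] at h1
    have h1' : ∃ i : ℕ, e1 = Finsupp.single i a := by
      by_contra h0; simp [h0] at h1
    obtain ⟨i, rfl⟩ := h1'
    have ha : 0 < a := hs a (Multiset.mem_cons_self _ _)
    obtain ⟨ih1, ih2⟩ := ih (fun b hb => hs b (Multiset.mem_cons_of_mem hb)) e2 h2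
    have hsupp : e.support = insert i e2.support := by
      subst hmem
      ext j
      simp only [Finsupp.mem_support_iff, Finsupp.add_apply, Finset.mem_insert,
        Finsupp.single_apply]
      split_ifs with hij
      · subst hij; constructor
        · intro _; exact Or.inl rfl
        · intro _; omega
      · constructor
        · intro h; right; simpa using h
        · rintro (h | h)
          · exact absurd h.symm hij
          · simpa using h
    rw [Multiset.card_cons]
    constructor
    · rw [hsupp]
      exact (Finset.card_insert_le _ _).trans (by omega)
    · intro hc
      have hi : i ∉ e2.support := by
        intro hi
        rw [hsupp, Finset.insert_eq_of_mem hi] at hc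
        omega
      rw [hsupp, Finset.card_insert_of_notMem hi] at hc
      rw [hsupp, Finset.insert_val_of_notMem hi, Multiset.map_cons]
      have hei : e i = a := by
        subst hmem
        have : e2 i = 0 := by simpa using hi
        simp [this]
      have hrest : e2.support.val.map e = e2.support.val.map e2 := by
        refine Multiset.map_congr rfl fun j hj => ?_
        have hji : i ≠ j := by rintro rfl; exact hi hj
        subst hmem
        simp [hji]
      rw [hei, hrest, ih2 (by omega)]

lemma exists_coeff_pos (s : Multiset ℕ) (hs : ∀ a ∈ s, 0 < a) :
    ∃ e : ℕ →₀ ℕ, e.support.card = s.card ∧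
      MvPowerSeries.coeff e (s.map (psum ℚ)).prod ≠ 0 := by
  classical
  induction s using Multiset.induction_on with
  | empty => exact ⟨0, by simp⟩
  | cons a s ih =>
    obtain ⟨e, he, hc⟩ := ih fun b hb => hs b (Multiset.mem_cons_of_mem hb)
    have ha : a ≠ 0 := (hs a (Multiset.mem_cons_self _ _)).ne'
    obtain ⟨i, hi⟩ := Infinite.exists_notMem_finset e.support
    refine ⟨Finsupp.single i a + e, ?_, ?_⟩
    · rw [Finsupp.support_add_eq, Finsupp.support_single _ ha, Finset.card_union_of_disjoint,
        he]
      · simp [add_comm]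
      · simpa using hi
      · rw [Finsupp.support_single _ ha]; simpa using hi
    · rw [Multiset.map_cons, Multiset.prod_cons, MvPowerSeries.coeff_mul]
      refine ne_of_gt (lt_of_lt_of_le ?_ (Finset.single_le_sum
        (fun p _ => mul_nonneg (coeff_psum_nonneg _ _) (coeff_prod_nonneg _ _))
        (Finset.HasAntidiagonal.mem_antidiagonal.2
          (rfl : (Finsupp.single i a, e).1 + (Finsupp.single i a, e).2 = _))))
      have h1 : MvPowerSeries.coeff (Finsupp.single i a) (psum ℚ a) = 1 := by
        rw [coeff_psum, if_pos ⟨i, rfl⟩]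
      simp only [h1, one_mul]
      exact lt_of_le_of_ne (coeff_prod_nonneg _ _) hc.symm

lemma linearIndependent_powerSum :
    LinearIndependent ℚ (fun mu : Σ n : ℕ, n.Partition => powerSum ℚ mu.2) := by
  classical
  rw [linearIndependent_iff]
  intro l hl
  by_contra hne
  obtain ⟨mu, hmu, hmax⟩ := Finset.exists_max_image l.support (fun mu => mu.2.parts.card)
    (Finsupp.support_nonempty_iff.2 hne)
  obtain ⟨e, he, hc⟩ := exists_coeff_pos mu.2.parts fun _ h => mu.2.parts_pos h
  have hmap := (card_support_le _ (fun _ h => mu.2.parts_pos h) e hc).2 he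
  have h0 := congrArg (MvPowerSeries.coeff e) hl
  rw [Finsupp.linearCombination_apply, Finsupp.sum, map_sum, map_zero,
    Finset.sum_eq_single mu] at h0
  · rw [MvPowerSeries.coeff_smul] at h0
    exact mul_ne_zero (Finsupp.mem_support_iff.1 hmu) hc h0
  · intro nu hnu hnm
    rw [MvPowerSeries.coeff_smul]
    by_contra hcn
    obtain ⟨h1, h2⟩ := card_support_le nu.2.parts (fun _ h => nu.2.parts_pos h) e
      (right_ne_zero_of_mul hcn)
    have h3 := h2 (le_antisymm h1 (he ▸ hmax nu hnu))
    apply hnm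
    have hp : nu.2.parts = mu.2.parts := h3.symm.trans hmap
    obtain ⟨a, nu⟩ := nu
    obtain ⟨b, mu⟩ := mu
    have hab : a = b := by
      have := congrArg Multiset.sum hp
      simpa [nu.parts_sum, mu.parts_sum] using this
    subst hab
    have : nu = mu := Nat.Partition.ext hp
    rw [this]
  · intro h; exact absurd hmu h

/-- `[p_lam] f`: the coefficient of `p_lam` in the decomposition of the symmetric function `f` in
the basis of power symmetric functions (indexed by the partitions of all integers); it is set to
`0` if `f` is not a linear combination of power symmetric functions. -/
def powerSumCoeff {n : ℕ} (lam : n.Partition) (f : MvPowerSeries ℕ ℚ) : ℚ :=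
  open Classical in
  if h : f ∈ Submodule.span ℚ (Set.range fun mu : Σ n : ℕ, n.Partition => powerSum ℚ mu.2)
  then linearIndependent_powerSum.repr ⟨f, h⟩ ⟨n, lam⟩
  else 0

/-! ### Separated permutations -/

/-- The set of permutations of `Fin n` of cycle type `lam` (fixed points count as parts `1`). -/
def permsOfType {n : ℕ} (lam : n.Partition) : Finset (Equiv.Perm (Fin n)) :=
  open Classical in Finset.univ.filter fun π => π.partition.parts = lam.parts

/-- Tuples `A = (A_1, …, A_k)` of pairwise disjoint subsets with `#A_i = α_i`, where `α` is a
composition with `k` parts. -/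
def tuples (n : ℕ) {m : ℕ} (α : Composition m) : Finset (Fin α.length → Finset (Fin n)) :=
  open Classical in Finset.univ.filter fun A =>
    (∀ i, (A i).card = α.blocksFun i) ∧ ∀ i j, i ≠ j → Disjoint (A i) (A j)

/-- `σ` is `A`-separated: no cycle of `σ` contains elements of more than one of the `A_i`. -/
def IsSeparated {n k : ℕ} (A : Fin k → Finset (Fin n)) (σ : Equiv.Perm (Fin n)) : Prop :=
  ∀ i j, i ≠ j → ∀ a ∈ A i, ∀ b ∈ A j, ¬ σ.SameCycle a b

/-- The number of cycles of `σ` (fixed points included) containing no element of any `A_i`. -/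
def freeCycles {n k : ℕ} (A : Fin k → Finset (Fin n)) (σ : Equiv.Perm (Fin n)) : ℕ :=
  Nat.card {c : Quotient (Equiv.Perm.SameCycle.setoid σ) //
    ∀ x : Fin n, Quotient.mk (Equiv.Perm.SameCycle.setoid σ) x = c → ∀ i, x ∉ A i}

/-- The set `S_lam^α` of pairs `(π, A)`, with `π` of cycle type `lam` and `A` a tuple of disjoint
subsets of sizes `α`, such that `π ∘ (1, 2, …, n)` is `A`-separated. -/
def sepPairs {n m : ℕ} (lam : n.Partition) (α : Composition m) :
    Finset (Equiv.Perm (Fin n) × (Fin α.length → Finset (Fin n))) :=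
  open Classical in
  (permsOfType lam ×ˢ tuples n α).filter fun x => IsSeparated x.2 (x.1 * finRotate n)

/-- The generating function `G_n^α(x, t)`, a power series in `x` with coefficients in `ℚ[t]`. -/
def genFun (n : ℕ) {m : ℕ} (α : Composition m) : MvPowerSeries ℕ (Polynomial ℚ) :=
  ∑ lam : n.Partition,
    (∑ x ∈ sepPairs lam α, (Polynomial.X : Polynomial ℚ) ^ freeCycles x.2 (x.1 * finRotate n)) •
      powerSum (Polynomial ℚ) lam

/-- The substitution `t ↦ t + k` in a series with coefficients in `ℚ[t]`. -/
def shiftT (k : ℕ) : MvPowerSeries ℕ (Polynomial ℚ) →+* MvPowerSeries ℕ (Polynomial ℚ) :=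
  MvPowerSeries.map (Polynomial.compRingHom (Polynomial.X + Polynomial.C (k : ℚ)))

/-- The specialization `t = a` of a series with coefficients in `ℚ[t]`. -/
def evalT (a : ℚ) : MvPowerSeries ℕ (Polynomial ℚ) →+* MvPowerSeries ℕ ℚ :=
  MvPowerSeries.map (Polynomial.evalRingHom a)

/-- The polynomial `binom(t, r) = t (t - 1) ⋯ (t - r + 1) / r!`. -/
def binomPoly (r : ℕ) : Polynomial ℚ :=
  Polynomial.C ((r ! : ℚ)⁻¹) * ∏ i ∈ Finset.range r, (Polynomial.X - Polynomial.C (i : ℚ))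

/-- The probability that `π ∘ ρ` is `A`-separated, where `π` and `ρ` are independent and uniformly
distributed among the permutations of cycle type `lam` and `mu` respectively. -/
def separationProb {n k : ℕ} (lam mu : n.Partition) (A : Fin k → Finset (Fin n)) : ℚ :=
  open Classical in
  (((permsOfType lam ×ˢ permsOfType mu).filter fun x => IsSeparated A (x.1 * x.2)).card : ℚ) /
    ((permsOfType lam).card * (permsOfType mu).card)

end

end SeparationProb

set_option linter.unusedSectionVars false

namespace SeparationProb

noncomputable section

open scoped Classical
open Equiv Finset

/-! Fix a monomial `x ^ e` involving ℓ variables and a natural number q, and let ζ be the cycle (1,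
…, n). Since `p_λ` is a product over the cycles of a permutation π of type λ, its coefficient at `x
^ e` counts the colorings f of [n] of content e that are constant on the cycles of π
(`coeff_powerSum`). Likewise (k + q)^u for a separated pair, and 0 for any other pair, counts the
colorings g with k + q colors that are constant on the cycles of πζ and give color i to A_i
(`card_separated_colorings`). After summation over A, the coefficient of G(x, q + k) is the number
of triples (π, f, g) weighted by ∏ binom(|g⁻¹(i)|, α_i) (`eval_coeff_shiftT_genFun`).

By conjugation this count is the same for every n-cycle ζ, so it may be averaged over all of them.
Then ζ = ασ, where α = π⁻¹ preserves f and σ = πζ preserves g. The heart of the proof is that, for a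
fixed σ, the number of pairs (f, α) with ασ an n-cycle is (n - ℓ)! times the number of (ℓ -
1)-tuples of distinct points whose removal leaves a point in every cycle of σ
(`sum_card_isFullCycle_mul`); the content of f matters only through ℓ. Colors are removed one at a
time by the exchange identity `sum_card_meets_mul`: choosing a color class together with a
permutation of it amounts, up to a falling factorial, to removing a single point. This rests on
first return maps: for κ a permutation of X, the cycles of κτ as seen on X are those of κ times the
first return map of τ to X.

Summing over the σ that preserve g leaves ∏ |g⁻¹(j)|! times a falling factorial depending only on
the number of colors used by g (`sum_erasureCount`). The factorials cancel against the number of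
colorings g of given content, and the remaining sum over contents is a coefficient of a power series
(`sum_piAntidiag_choose_mul`). Agreement at all natural q gives the polynomial identity. Its right
side involves only n, m and k, and t ↦ t + k is injective on series, whence the last claim. At t = 1
the linear independence of the `p_λ` isolates #S_λ, and the probability comes from double counting
triples (π, ρ, A) with ρ an n-cycle. -/

/-! ### First return permutations -/

section FirstReturn

variable {E : Type*} [Fintype E] [DecidableEq E]

/-- The permutations fixing every element outside `X`. -/
def permsOn (X : Finset E) : Finset (Perm E) :=
  univ.filter fun κ => ∀ x, x ∉ X → κ x = x

/-- Every cycle of `τ` contains an element of `U`. -/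
def Meets (τ : Perm E) (U : Finset E) : Prop :=
  ∀ x, ∃ u ∈ U, τ.SameCycle x u

/-- The first positive time at which the orbit of `x` under `τ` visits `X`. -/
def returnTime (τ : Perm E) (X : Finset E) (x : E) : ℕ :=
  sInf {k | 0 < k ∧ (τ ^ k) x ∈ X}

lemma mem_permsOn {X : Finset E} {κ : Perm E} :
    κ ∈ permsOn X ↔ ∀ x, x ∉ X → κ x = x := by
  simp [permsOn]

lemma apply_mem_of_mem_permsOn {X : Finset E} {κ : Perm E} (h : κ ∈ permsOn X) {x : E} :
    κ x ∈ X ↔ x ∈ X := by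
  rw [mem_permsOn] at h
  constructor
  · intro hx
    by_contra h1
    rw [h x h1] at hx
    exact h1 hx
  · intro hx
    by_contra h1
    have := κ.injective (h _ h1)
    rw [this] at h1
    exact h1 hx

lemma mul_mem_permsOn {X : Finset E} {κ κ' : Perm E} (h : κ ∈ permsOn X) (h' : κ' ∈ permsOn X) :
    κ * κ' ∈ permsOn X := by
  rw [mem_permsOn] at *
  intro x hx
  rw [Perm.mul_apply, h' x hx, h x hx]

lemma inv_mem_permsOn {X : Finset E} {κ : Perm E} (h : κ ∈ permsOn X) : κ⁻¹ ∈ permsOn X := by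
  rw [mem_permsOn] at *
  intro x hx
  rw [Perm.inv_eq_iff_eq, h x hx]

lemma permsOn_mono {X Z : Finset E} (hXZ : X ⊆ Z) : permsOn X ⊆ permsOn Z := by
  intro κ h
  rw [mem_permsOn] at *
  exact fun x hx => h x fun h' => hx (hXZ h')

lemma card_permsOn (X : Finset E) : (permsOn X).card = X.card ! := by
  have h := Fintype.card_congr (Perm.subtypeEquivSubtypePerm fun x => x ∈ X)
  rw [Fintype.card_perm, Fintype.card_coe, Fintype.card_subtype] at h
  exact h.symm

lemma sum_permsOn_mul_right {M : Type*} [AddCommMonoid M] {X : Finset E} {ρ : Perm E}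
    (hρ : ρ ∈ permsOn X) (F : Perm E → M) :
    ∑ κ ∈ permsOn X, F (κ * ρ) = ∑ κ ∈ permsOn X, F κ := by
  refine sum_bij' (fun κ _ => κ * ρ) (fun κ _ => κ * ρ⁻¹) ?_ ?_ ?_ ?_ ?_
  · intro κ h; exact mul_mem_permsOn h hρ
  · intro κ h; exact mul_mem_permsOn h (inv_mem_permsOn hρ)
  · intros; simp
  · intros; simp
  · intros; rfl

lemma returnTime_nonempty (τ : Perm E) {X : Finset E} {x : E} (hx : ∃ y ∈ X, τ.SameCycle x y) :
    {k | 0 < k ∧ (τ ^ k) x ∈ X}.Nonempty := by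
  obtain ⟨y, hy, hxy⟩ := hx
  obtain ⟨i, hi, -, h⟩ := hxy.exists_pow_eq''
  exact ⟨i, hi, by rwa [h]⟩

lemma returnTime_spec (τ : Perm E) {X : Finset E} {x : E} (hx : ∃ y ∈ X, τ.SameCycle x y) :
    0 < returnTime τ X x ∧ (τ ^ returnTime τ X x) x ∈ X :=
  Nat.sInf_mem (returnTime_nonempty τ hx)

lemma notMem_of_lt_returnTime {τ : Perm E} {X : Finset E} {x : E} {k : ℕ} (h0 : 0 < k)
    (hk : k < returnTime τ X x) : (τ ^ k) x ∉ X :=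
  fun h => Nat.notMem_of_lt_sInf hk ⟨h0, h⟩

lemma returnTime_le {τ : Perm E} {X : Finset E} {x : E} {k : ℕ} (h0 : 0 < k)
    (h : (τ ^ k) x ∈ X) : returnTime τ X x ≤ k :=
  Nat.sInf_le ⟨h0, h⟩

lemma returnTime_pos {τ : Perm E} {X : Finset E} {x : E} (hx : x ∈ X) :
    0 < returnTime τ X x := (returnTime_spec τ ⟨x, hx, .rfl⟩).1

lemma pow_returnTime_mem {τ : Perm E} {X : Finset E} {x : E} (hx : x ∈ X) :
    (τ ^ returnTime τ X x) x ∈ X := (returnTime_spec τ ⟨x, hx, .rfl⟩).2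

/-- If two returns coincide, cancelling the smaller power of `τ` puts one starting point on the
orbit of the other strictly before its return time, so the time difference is zero. -/
lemma pow_returnTime_injOn (τ : Perm E) (X : Finset E) :
    Set.InjOn (fun x => (τ ^ returnTime τ X x) x) X := by
  have key : ∀ x ∈ X, ∀ y ∈ X, returnTime τ X x ≤ returnTime τ X y →
      (τ ^ returnTime τ X x) x = (τ ^ returnTime τ X y) y → x = y := by
    intro x hx y hy hle h
    obtain ⟨d, hd⟩ := Nat.exists_eq_add_of_le hle
    rw [hd, pow_add, Perm.mul_apply] at h
    have h1 := (τ ^ returnTime τ X x).injective h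
    rcases Nat.eq_zero_or_pos d with rfl | hd0
    · simpa using h1
    · exact absurd (h1 ▸ hx) (notMem_of_lt_returnTime hd0
        (by have := returnTime_pos (τ := τ) hx; omega))
  intro x hx y hy h
  rcases le_total (returnTime τ X x) (returnTime τ X y) with hle | hle
  · exact key x hx y hy hle h
  · exact (key y hy x hx hle h.symm).symm

/-- The permutation mapping each element of `X` to the next element of `X` in its cycle under
`τ`, and fixing the other elements. -/
def firstReturn (τ : Perm E) (X : Finset E) : Perm E :=
  Equiv.ofBijective (fun x => if x ∈ X then (τ ^ returnTime τ X x) x else x) <| by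
    rw [← Finite.injective_iff_bijective]
    intro x y h
    simp only at h
    split_ifs at h with hx hy hy
    · exact pow_returnTime_injOn τ X hx hy h
    · exact absurd (h ▸ pow_returnTime_mem hx) hy
    · exact absurd (h ▸ pow_returnTime_mem hy) hx
    · exact h

lemma firstReturn_apply {τ : Perm E} {X : Finset E} {x : E} (hx : x ∈ X) :
    firstReturn τ X x = (τ ^ returnTime τ X x) x := by
  simp [firstReturn, hx]

lemma firstReturn_mem_permsOn (τ : Perm E) (X : Finset E) : firstReturn τ X ∈ permsOn X := by
  rw [mem_permsOn]
  intro x hx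
  simp [firstReturn, hx]

/-- Since `κ` moves only points of `X`, it has no effect until `τ` first visits `X`; at time `k` it
may act once, except at time 0, where no step has been made. -/
lemma mul_pow_apply {τ κ : Perm E} {X : Finset E} (hκ : κ ∈ permsOn X) {x : E} {k : ℕ}
    (h : ∀ j, 0 < j → j < k → (τ ^ j) x ∉ X) :
    ((κ * τ) ^ k) x = if k = 0 then x else κ ((τ ^ k) x) := by
  induction k with
  | zero => simp
  | succ k ih =>
    rw [pow_succ', Perm.mul_apply, ih fun j h0 hj => h j h0 (by omega)]
    rcases Nat.eq_zero_or_pos k with rfl | hk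
    · simp
    · rw [if_neg hk.ne', mem_permsOn.1 hκ _ (h k hk (by omega)), if_neg (by omega), pow_succ',
        Perm.mul_apply, Perm.mul_apply]

lemma mul_pow_apply_of_lt {τ κ : Perm E} {X : Finset E} (hκ : κ ∈ permsOn X) {x : E} {k : ℕ}
    (h : k < returnTime τ X x) : ((κ * τ) ^ k) x = (τ ^ k) x := by
  rw [mul_pow_apply hκ fun j h0 hj => notMem_of_lt_returnTime h0 (hj.trans h)]
  split_ifs with hk
  · simp [hk]
  · exact mem_permsOn.1 hκ _ (notMem_of_lt_returnTime (Nat.pos_of_ne_zero hk) h)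

lemma mul_pow_returnTime {τ κ : Perm E} {X : Finset E} (hκ : κ ∈ permsOn X) {x : E}
    (hx : x ∈ X) : ((κ * τ) ^ returnTime τ X x) x = (κ * firstReturn τ X) x := by
  rw [mul_pow_apply hκ fun j h0 hj => notMem_of_lt_returnTime h0 hj,
    if_neg (returnTime_pos hx).ne', Perm.mul_apply, firstReturn_apply hx]

lemma mul_firstReturn_mem {τ κ : Perm E} {X : Finset E} (hκ : κ ∈ permsOn X) {x : E}
    (hx : x ∈ X) : (κ * firstReturn τ X) x ∈ X :=
  (apply_mem_of_mem_permsOn (mul_mem_permsOn hκ (firstReturn_mem_permsOn τ X))).2 hx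

lemma sameCycle_of_sameCycle_firstReturn {τ κ : Perm E} {X : Finset E} (hκ : κ ∈ permsOn X)
    {x y : E} (hx : x ∈ X) (h : (κ * firstReturn τ X).SameCycle x y) :
    (κ * τ).SameCycle x y := by
  obtain ⟨k, rfl⟩ := h.exists_nat_pow_eq
  clear h
  induction k generalizing x with
  | zero => exact .rfl
  | succ k ih =>
    rw [pow_succ, Perm.mul_apply]
    refine .trans ?_ (ih (mul_firstReturn_mem hκ hx))
    rw [← mul_pow_returnTime hκ hx, Perm.sameCycle_pow_right]

/-- Along the orbit of an element of `X` under `κ * τ`, every visited element lies on the segment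
between two consecutive visits to `X` of an orbit of `τ`. -/
lemma exists_segment {τ κ : Perm E} {X : Finset E} (hκ : κ ∈ permsOn X) {x y : E} (hx : x ∈ X)
    (h : (κ * τ).SameCycle x y) :
    ∃ z ∈ X, (κ * firstReturn τ X).SameCycle x z ∧
      ∃ j < returnTime τ X z, (τ ^ j) z = y := by
  obtain ⟨k, rfl⟩ := h.exists_nat_pow_eq
  clear h
  induction k using Nat.strong_induction_on generalizing x with
  | _ k ih =>
    by_cases hk : k < returnTime τ X x
    · exact ⟨x, hx, .rfl, k, hk, (mul_pow_apply_of_lt hκ hk).symm⟩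
    -- Past the first return, the orbit restarts at the point of `X` reached, with strictly less
    -- time left.
    · obtain ⟨z, hz, hs, j, hj, h⟩ := ih (k - returnTime τ X x)
        (by have := returnTime_pos (τ := τ) hx; omega) (mul_firstReturn_mem (τ := τ) hκ hx)
      refine ⟨z, hz, Perm.sameCycle_apply_left.1 hs, j, hj, ?_⟩
      rw [h, ← mul_pow_returnTime hκ hx, ← Perm.mul_apply, ← pow_add]
      congr 2
      omega

/-- The main use of first returns: on `X`, cycles of `κ * τ` are cycles of a permutation of `X`.
When `κ` runs over `permsOn X`, so does `κ * firstReturn τ X`, so counting over `κ` no longer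
involves `τ`. -/
lemma sameCycle_mul_iff {τ κ : Perm E} {X : Finset E} (hκ : κ ∈ permsOn X) {x y : E}
    (hx : x ∈ X) (hy : y ∈ X) :
    (κ * τ).SameCycle x y ↔ (κ * firstReturn τ X).SameCycle x y := by
  refine ⟨fun h => ?_, sameCycle_of_sameCycle_firstReturn hκ hx⟩
  obtain ⟨z, hz, hs, j, hj, rfl⟩ := exists_segment hκ hx h
  rcases Nat.eq_zero_or_pos j with rfl | hj0
  · simpa using hs
  · exact absurd hy (notMem_of_lt_returnTime hj0 hj)

/-- Changing `τ` by a permutation of `X` does not affect which elements reach `X`. -/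
lemma meets_mul {τ κ : Perm E} {X : Finset E} (hκ : κ ∈ permsOn X) {x : E}
    (h : ∃ u ∈ X, τ.SameCycle x u) : ∃ u ∈ X, (κ * τ).SameCycle x u := by
  obtain ⟨h0, h1⟩ := returnTime_spec τ h
  refine ⟨κ ((τ ^ returnTime τ X x) x), (apply_mem_of_mem_permsOn hκ).2 h1, ?_⟩
  have := mul_pow_apply (τ := τ) hκ (x := x) (k := returnTime τ X x)
    fun j h0 hj => notMem_of_lt_returnTime h0 hj
  rw [if_neg h0.ne'] at this
  rw [← this, Perm.sameCycle_pow_right]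

lemma meets_mul_iff {τ κ : Perm E} {X : Finset E} (hκ : κ ∈ permsOn X) :
    Meets (κ * τ) X ↔ Meets τ X := by
  refine ⟨fun h x => ?_, fun h x => meets_mul hκ (h x)⟩
  simpa using meets_mul (inv_mem_permsOn hκ) (h x)

lemma Meets.mono {τ : Perm E} {U V : Finset E} (h : Meets τ U) (hUV : U ⊆ V) : Meets τ V :=
  fun x => (h x).imp fun _ hu => ⟨hUV hu.1, hu.2⟩

end FirstReturn

/-! ### Counting permutations of a subset by the cycles of a product -/

section Counting

variable {E : Type*} [Fintype E] [DecidableEq E]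

/-- `τ` has a single cycle (fixed points being cycles). -/
def IsFullCycle (τ : Perm E) : Prop := ∀ x y, τ.SameCycle x y

/-- The only excursion out of `X` is from `y` to `a` and back. Hence `κ * swap a y`, for `κ` a
permutation of `X`, is `κ` with `a` inserted in a cycle, and its cycles on `X` are unchanged. -/
lemma firstReturn_swap {X : Finset E} {a y : E} (ha : a ∉ X) (hy : y ∈ X) :
    firstReturn (swap a y) X = 1 := by
  ext x
  by_cases hx : x ∈ X
  · rw [firstReturn_apply hx, Perm.one_apply]
    have h2 : returnTime (swap a y) X x ≤ 2 :=
      returnTime_le (by norm_num) (by simpa [pow_two] using hx)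
    have h1 := returnTime_pos (τ := swap a y) hx
    have h3 := pow_returnTime_mem (τ := swap a y) hx
    obtain h | h : returnTime (swap a y) X x = 1 ∨ returnTime (swap a y) X x = 2 := by omega
    · rw [h, pow_one] at h3 ⊢
      by_cases hxy : x = y
      · subst hxy
        rw [swap_apply_right] at h3
        exact absurd h3 ha
      · exact swap_apply_of_ne_of_ne (by rintro rfl; exact ha hx) hxy
    · simp [h, pow_two]
  · rw [mem_permsOn.1 (firstReturn_mem_permsOn _ X) x hx, Perm.one_apply]

/-- Induction on `X`: a point `a` of `X` outside `M` is deleted from its cycle. Its predecessor can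
be any of the other points of `X`, and the deletion does not affect which of them reach `M`. When `M
= X` there is no condition. -/
lemma card_permsOn_reach (X M : Finset E) (hM : M ⊆ X) (hX : X.Nonempty) :
    ((permsOn X).filter fun κ => ∀ x ∈ X, ∃ y ∈ M, κ.SameCycle x y).card =
      M.card * (X.card - 1)! := by
  induction hc : X.card using Nat.strong_induction_on generalizing X with
  | _ N ih =>
  subst hc
  by_cases hMX : M = X
  · subst hMX
    rw [filter_true_of_mem fun κ _ x hx => ⟨x, hx, .rfl⟩, card_permsOn,
      Nat.mul_factorial_pred hX.card_pos.ne']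
  obtain ⟨a, haX, haM⟩ := exists_of_ssubset (hM.ssubset_of_ne hMX)
  have hM' : M ⊆ X.erase a := fun x hx => mem_erase.2 ⟨by rintro rfl; exact haM hx, hM hx⟩
  have hcard := card_erase_add_one haX
  have key : ∀ y ∈ X.erase a,
      (((permsOn X).filter fun κ => ∀ x ∈ X, ∃ y ∈ M, κ.SameCycle x y).filter
        fun κ => κ⁻¹ a = y).card =
      ((permsOn (X.erase a)).filter fun κ => ∀ x ∈ X.erase a, ∃ y ∈ M, κ.SameCycle x y).card := by
    intro y hy
    have hyX := mem_of_mem_erase hy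
    have hs : swap a y ∈ permsOn X := by
      rw [mem_permsOn]
      intro x hx
      exact swap_apply_of_ne_of_ne (by rintro rfl; exact hx haX) (by rintro rfl; exact hx hyX)
    have hiff : ∀ κ ∈ permsOn (X.erase a),
        (∀ x ∈ X, ∃ m ∈ M, (κ * swap a y).SameCycle x m) ↔
          ∀ x ∈ X.erase a, ∃ m ∈ M, κ.SameCycle x m := by
      intro κ hκ
      have h1 : ∀ x ∈ X.erase a, ∀ m ∈ M, (κ * swap a y).SameCycle x m ↔ κ.SameCycle x m := by
        intro x hx m hm
        rw [sameCycle_mul_iff hκ hx (hM' hm), firstReturn_swap (by simp) hy, mul_one]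
      constructor
      · intro h x hx
        obtain ⟨m, hm, hxm⟩ := h x (mem_of_mem_erase hx)
        exact ⟨m, hm, (h1 x hx m hm).1 hxm⟩
      · intro h x hx
        by_cases hxa : x = a
        · subst hxa
          have hκy := (apply_mem_of_mem_permsOn hκ).2 hy
          obtain ⟨m, hm, hxm⟩ := h _ hκy
          refine ⟨m, hm, ?_⟩
          rw [← h1 _ hκy m hm] at hxm
          rw [← Perm.sameCycle_apply_left]
          simpa using hxm
        · have hx' := mem_erase.2 ⟨hxa, hx⟩
          obtain ⟨m, hm, hxm⟩ := h x hx'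
          exact ⟨m, hm, (h1 x hx' m hm).2 hxm⟩
    refine card_bij' (fun κ _ => κ * swap a y) (fun κ _ => κ * swap a y) ?_ ?_ ?_ ?_
    · intro κ hκ
      simp only [mem_filter] at hκ ⊢
      obtain ⟨⟨hκ, hr⟩, hay⟩ := hκ
      rw [Perm.inv_eq_iff_eq] at hay
      have h1 : κ * swap a y ∈ permsOn (X.erase a) := by
        rw [mem_permsOn]
        intro x hx
        by_cases hxa : x = a
        · simp [hxa, hay]
        · exact mem_permsOn.1 (mul_mem_permsOn hκ hs) x fun h => hx (mem_erase.2 ⟨hxa, h⟩)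
      refine ⟨h1, ?_⟩
      rw [← hiff _ h1]
      simpa [mul_assoc] using hr
    · intro κ hκ
      simp only [mem_filter] at hκ ⊢
      obtain ⟨hκ, hr⟩ := hκ
      refine ⟨⟨mul_mem_permsOn (permsOn_mono (erase_subset _ _) hκ) hs, (hiff κ hκ).2 hr⟩, ?_⟩
      rw [Perm.inv_eq_iff_eq]
      simpa using (mem_permsOn.1 hκ a (by simp)).symm
    · intros; simp [mul_assoc]
    · intros; simp [mul_assoc]
  rw [card_eq_sum_card_fiberwise (f := fun κ => κ⁻¹ a) (t := X), ← add_sum_erase _ _ haX,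
    sum_congr rfl key, sum_const, smul_eq_mul]
  -- The fiber where `a` is its own predecessor is empty: a fixed point outside `M` cannot reach
  -- `M`.
  · have h0 : (((permsOn X).filter fun κ => ∀ x ∈ X, ∃ y ∈ M, κ.SameCycle x y).filter
        fun κ => κ⁻¹ a = a).card = 0 := by
      rw [card_eq_zero, filter_eq_empty_iff]
      intro κ hκ h
      obtain ⟨m, hm, ham⟩ := (mem_filter.1 hκ).2 a haX
      rw [Perm.inv_eq_iff_eq] at h
      have := ham.eq_of_left h.symm
      exact haM (this ▸ hm)
    rw [h0, zero_add]
    rcases (X.erase a).eq_empty_or_nonempty with he | hne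
    · rw [he] at hM' ⊢
      simp [subset_empty.1 hM']
    · rw [ih _ (by omega) (X.erase a) hM' hne rfl, mul_left_comm,
        Nat.mul_factorial_pred hne.card_pos.ne']
      congr 2
      omega
  · intro κ hκ
    exact (apply_mem_of_mem_permsOn (inv_mem_permsOn (mem_filter.1 hκ).1)).2 haX

/-- A cycle of `τ` that avoids `R` survives in every `κ * τ`. Otherwise everything is decided on
`R`, where translation by the first return map reduces to counting the cyclic permutations of `R`,
i.e. those in which every point reaches a chosen `r`. -/
lemma card_isFullCycle_mul (τ : Perm E) {R : Finset E} (hR : R.Nonempty) :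
    ((permsOn R).filter fun κ => IsFullCycle (κ * τ)).card =
      if Meets τ R then (R.card - 1)! else 0 := by
  obtain ⟨r, hr⟩ := hR
  split_ifs with h
  · have hiff : ∀ κ ∈ permsOn R, IsFullCycle (κ * τ) ↔
        ∀ x ∈ R, ∃ y ∈ ({r} : Finset E), (κ * firstReturn τ R).SameCycle x y := by
      intro κ hκ
      simp only [mem_singleton, exists_eq_left]
      constructor
      · exact fun hf x hx => (sameCycle_mul_iff hκ hx hr).1 (hf x r)
      · intro hf
        have h1 : ∀ x, (κ * τ).SameCycle x r := by
          intro x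
          obtain ⟨u, hu, hxu⟩ := meets_mul hκ (h x)
          exact hxu.trans ((sameCycle_mul_iff hκ hu hr).2 (hf u hu))
        exact fun x y => (h1 x).trans (h1 y).symm
    rw [filter_congr hiff, card_filter,
      sum_permsOn_mul_right (firstReturn_mem_permsOn τ R) fun κ => if
        ∀ x ∈ R, ∃ y ∈ ({r} : Finset E), κ.SameCycle x y then 1 else 0,
      ← card_filter, card_permsOn_reach R {r} (by simpa using hr) ⟨r, hr⟩]
    simp
  · rw [card_eq_zero, filter_eq_empty_iff]
    intro κ hκ hf
    exact h ((meets_mul_iff hκ).1 fun x => ⟨r, hr, hf x r⟩)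

/-- A cycle of `κ * τ` through `X` is a concatenation of `τ`-segments, each starting at a point of
`X`; it meets `U` exactly when one of them does. Time `j = 0` is allowed, so the starting point
itself counts. -/
lemma meets_mul_union_iff {τ κ : Perm E} {X U : Finset E} (hκ : κ ∈ permsOn X)
    (h : Meets τ (U ∪ X)) :
    Meets (κ * τ) U ↔ ∀ x ∈ X, ∃ y ∈ X.filter (fun y => ∃ j < returnTime τ X y, (τ ^ j) y ∈ U),
      (κ * firstReturn τ X).SameCycle x y := by
  constructor
  · intro hm x hx
    obtain ⟨u, hu, hxu⟩ := hm x
    obtain ⟨z, hz, hs, j, hj, rfl⟩ := exists_segment hκ hx hxu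
    exact ⟨z, mem_filter.2 ⟨hz, j, hj, hu⟩, hs⟩
  · intro hm
    have h1 : ∀ x ∈ X, ∃ u ∈ U, (κ * τ).SameCycle x u := by
      intro x hx
      obtain ⟨y, hy, hs⟩ := hm x hx
      obtain ⟨hy, j, hj, hu⟩ := mem_filter.1 hy
      refine ⟨_, hu, (sameCycle_of_sameCycle_firstReturn hκ hx hs).trans ?_⟩
      rw [← mul_pow_apply_of_lt hκ hj, Perm.sameCycle_pow_right]
    intro x
    obtain ⟨u, hu, hs⟩ := meets_mul (permsOn_mono subset_union_right hκ) (h x)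
    rcases mem_union.1 hu with hu | hu
    · exact ⟨u, hu, hs⟩
    · obtain ⟨v, hv, hv'⟩ := h1 u hu
      exact ⟨v, hv, hs.trans hv'⟩

lemma card_meets_mul {τ : Perm E} {X U : Finset E} (hX : X.Nonempty)
    (h : Meets τ (U ∪ X)) :
    ((permsOn X).filter fun κ => Meets (κ * τ) U).card =
      (X.filter fun y => ∃ j < returnTime τ X y, (τ ^ j) y ∈ U).card * (X.card - 1)! := by
  rw [filter_congr fun κ hκ => meets_mul_union_iff hκ h, card_filter,
      sum_permsOn_mul_right (firstReturn_mem_permsOn τ X) fun κ => if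
        ∀ x ∈ X, ∃ y ∈ X.filter (fun y => ∃ j < returnTime τ X y, (τ ^ j) y ∈ U),
          κ.SameCycle x y then 1 else 0,
      ← card_filter, card_permsOn_reach X _ (filter_subset _ _) hX]

/-- After `x`, the orbit either meets `X` or `Z \ X` first. This turns a condition on a whole
segment into one on `x` and its successor in `Z`, a map that does not depend on `X`. -/
lemma exists_lt_returnTime_iff {τ : Perm E} {X Z : Finset E} (hXZ : X ⊆ Z) {x : E} (hx : x ∈ X) :
    (∃ j < returnTime τ X x, (τ ^ j) x ∈ Z \ X) ↔ firstReturn τ Z x ∉ X := by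
  rw [firstReturn_apply (hXZ hx)]
  constructor
  · rintro ⟨j, hj, hjZ⟩ h
    have h1 : returnTime τ X x ≤ returnTime τ Z x := returnTime_le (returnTime_pos (hXZ hx)) h
    have hj0 : 0 < j := by
      rcases Nat.eq_zero_or_pos j with rfl | h
      · simp [hx] at hjZ
      · exact h
    exact notMem_of_lt_returnTime hj0 (hj.trans_le h1) (mem_sdiff.1 hjZ).1
  · intro h
    refine ⟨returnTime τ Z x, ?_, mem_sdiff.2 ⟨pow_returnTime_mem (hXZ hx), h⟩⟩
    have h1 : returnTime τ Z x ≤ returnTime τ X x :=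
      returnTime_le (returnTime_pos hx) (hXZ (pow_returnTime_mem hx))
    refine lt_of_le_of_ne h1 fun h2 => h ?_
    rw [h2]
    exact pow_returnTime_mem hx

/-- Both sides say that `x` is not the only point of `Z` on its cycle. -/
lemma firstReturn_ne_iff {τ : Perm E} {Z : Finset E} (h : Meets τ Z) {x : E} (hx : x ∈ Z) :
    firstReturn τ Z x ≠ x ↔ Meets τ (Z.erase x) := by
  rw [firstReturn_apply hx]
  constructor
  · intro hne y
    obtain ⟨w, hw, hyw⟩ := h y
    by_cases hwx : w = x
    · subst hwx
      exact ⟨_, mem_erase.2 ⟨hne, pow_returnTime_mem hw⟩, by simpa using hyw⟩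
    · exact ⟨w, mem_erase.2 ⟨hwx, hw⟩, hyw⟩
  · intro hm heq
    obtain ⟨u, hu, hxu⟩ := hm x
    obtain ⟨hux, huZ⟩ := mem_erase.1 hu
    have hxu' : (1 * τ).SameCycle x u := by simpa using hxu
    have h1 : (1 : Perm E) ∈ permsOn Z := by simp [mem_permsOn]
    rw [sameCycle_mul_iff h1 hx huZ, one_mul] at hxu'
    exact hux (hxu'.eq_of_left (by rw [Function.IsFixedPt, firstReturn_apply hx, heq])).symm

lemma card_powersetCard_mem_notMem {Z : Finset E} {x y : E} (hx : x ∈ Z) (hy : y ∈ Z)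
    (hxy : y ≠ x) {s : ℕ} (hs : 1 ≤ s) :
    ((Z.powersetCard s).filter fun X => x ∈ X ∧ y ∉ X).card = (Z.card - 2).choose (s - 1) := by
  have hc : ((Z.erase x).erase y).card = Z.card - 2 := by
    rw [card_erase_of_mem (mem_erase.2 ⟨hxy, hy⟩), card_erase_of_mem hx]
    omega
  rw [← hc, ← card_powersetCard]
  refine card_bij' (fun X _ => X.erase x) (fun X _ => insert x X) ?_ ?_ ?_ ?_
  · intro X hX
    simp only [mem_filter, mem_powersetCard] at hX ⊢
    obtain ⟨⟨h1, h2⟩, h3, h4⟩ := hX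
    refine ⟨fun z hz => ?_, by rw [card_erase_of_mem h3, h2]⟩
    obtain ⟨hz1, hz2⟩ := mem_erase.1 hz
    exact mem_erase.2 ⟨by rintro rfl; exact h4 hz2, mem_erase.2 ⟨hz1, h1 hz2⟩⟩
  · intro X hX
    simp only [mem_filter, mem_powersetCard] at hX ⊢
    obtain ⟨h1, h2⟩ := hX
    have hxX : x ∉ X := fun h => by simpa using h1 h
    refine ⟨⟨insert_subset hx fun z hz => ?_, by rw [card_insert_of_notMem hxX, h2]; omega⟩,
      mem_insert_self _ _, ?_⟩
    · exact mem_of_mem_erase (mem_of_mem_erase (h1 hz))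
    · rw [mem_insert]
      rintro (h | h)
      · exact hxy h
      · simpa using h1 h
  · intro X hX
    exact insert_erase (mem_filter.1 hX).2.1
  · intro X hX
    exact erase_insert fun h => by simpa using (mem_powersetCard.1 hX).1 h

/-- The exchange identity: the number of pairs `(X, κ)` with `κ` a permutation of the `s`-subset
`X` of `Z` such that the cycles of `κ * τ` all meet `Z \ X`. -/
lemma sum_card_meets_mul (τ : Perm E) (Z : Finset E) {s : ℕ} (hs : 1 ≤ s) :
    ∑ X ∈ Z.powersetCard s, ((permsOn X).filter fun κ => Meets (κ * τ) (Z \ X)).card =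
      (Z.card - 2).descFactorial (s - 1) * (Z.filter fun x => Meets τ (Z.erase x)).card := by
  by_cases h : Meets τ Z
  · have h1 : ∀ X ∈ Z.powersetCard s,
        ((permsOn X).filter fun κ => Meets (κ * τ) (Z \ X)).card =
          (s - 1)! * ∑ x ∈ Z, if x ∈ X ∧ firstReturn τ Z x ∉ X then 1 else 0 := by
      intro X hX
      obtain ⟨hXZ, hXs⟩ := mem_powersetCard.1 hX
      have hne : X.Nonempty := by rw [← card_pos]; omega
      rw [card_meets_mul hne (by rwa [sdiff_union_of_subset hXZ]), mul_comm, hXs,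
        filter_congr fun x hx => exists_lt_returnTime_iff hXZ hx, ← card_filter]
      congr 2
      ext x
      simp only [mem_filter]
      exact ⟨fun hx => ⟨hXZ hx.1, hx⟩, fun hx => hx.2⟩
    -- Double counting: for each `x` in `Z`, count the subsets `X` that contain `x` but not its
    -- successor in `Z`.
    rw [sum_congr rfl h1, ← mul_sum, sum_comm]
    simp only [← card_filter]
    have h2 : ∀ x ∈ Z, ((Z.powersetCard s).filter fun X => x ∈ X ∧ firstReturn τ Z x ∉ X).card =
        if Meets τ (Z.erase x) then (Z.card - 2).choose (s - 1) else 0 := by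
      intro x hx
      rw [← firstReturn_ne_iff h hx]
      split_ifs with hne
      · exact card_powersetCard_mem_notMem hx
          ((apply_mem_of_mem_permsOn (firstReturn_mem_permsOn τ Z)).2 hx) hne hs
      · rw [card_eq_zero, filter_eq_empty_iff]
        rintro X - ⟨h3, h4⟩
        rw [not_not.1 hne] at h4
        exact h4 h3
    rw [sum_congr rfl h2, ← sum_filter, sum_const, smul_eq_mul,
      Nat.descFactorial_eq_factorial_mul_choose]
    ring
  · rw [filter_false_of_mem fun x _ hx => h (hx.mono (erase_subset _ _)), card_empty, mul_zero]
    refine sum_eq_zero fun X hX => ?_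
    have hXZ := (mem_powersetCard.1 hX).1
    rw [card_eq_zero, filter_eq_empty_iff]
    exact fun κ hκ hm => h ((meets_mul_iff (permsOn_mono hXZ hκ)).1 (hm.mono sdiff_subset))

end Counting

/-! ### Colored factorizations of a full cycle with a prescribed second factor -/

section Colorings

variable {E ι : Type*} [Fintype E] [DecidableEq E] [DecidableEq ι]

/-- The permutations which preserve the coloring `f`, and fix the elements whose color is not
in `s`. -/
def colorPreserving (s : Finset ι) (f : E → ι) : Finset (Perm E) :=
  univ.filter fun α => ∀ x, f (α x) = f x ∧ (f x ∉ s → α x = x)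

lemma mem_colorPreserving {s : Finset ι} {f : E → ι} {α : Perm E} :
    α ∈ colorPreserving s f ↔ ∀ x, f (α x) = f x ∧ (f x ∉ s → α x = x) := by
  simp [colorPreserving]

lemma colorPreserving_empty (f : E → ι) : colorPreserving ∅ f = {1} := by
  ext α
  simp only [mem_colorPreserving, notMem_empty, not_false_eq_true, true_implies, mem_singleton]
  constructor
  · intro h
    ext x
    exact (h x).2
  · rintro rfl x
    simp

/-- Such a permutation factors uniquely into a permutation of the color class of `i` and one acting
on the classes of colors in `s`. -/
lemma sum_colorPreserving_insert {M : Type*} [AddCommMonoid M] {s : Finset ι} {i : ι}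
    (hi : i ∉ s) (f : E → ι) (F : Perm E → M) :
    ∑ α ∈ colorPreserving (insert i s) f, F α =
      ∑ α ∈ colorPreserving s f, ∑ κ ∈ permsOn (univ.filter fun x => f x = i), F (κ * α) := by
  have hfix : ∀ α ∈ colorPreserving s f, ∀ x, f x = i → α x = x := fun α hα x hx =>
    (mem_colorPreserving.1 hα x).2 (hx ▸ hi)
  have hfix' : ∀ κ ∈ permsOn (univ.filter fun x => f x = i), ∀ x, f x ≠ i → κ x = x :=
    fun κ hκ x hx => mem_permsOn.1 hκ x (by simpa using hx)
  have hpres : ∀ κ ∈ permsOn (univ.filter fun x => f x = i), ∀ x, f (κ x) = f x := by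
    intro κ hκ x
    by_cases hx : f x = i
    · have := (apply_mem_of_mem_permsOn hκ (x := x)).2 (by simpa using hx)
      rw [hx]
      simpa using this
    · rw [hfix' κ hκ x hx]
  rw [← sum_product']
  symm
  refine sum_bij (fun p _ => p.2 * p.1) ?_ ?_ ?_ fun _ _ => rfl
  · rintro ⟨α, κ⟩ h
    obtain ⟨hα, hκ⟩ := mem_product.1 h
    rw [mem_colorPreserving]
    intro x
    refine ⟨by rw [Perm.mul_apply, hpres κ hκ, (mem_colorPreserving.1 hα x).1], fun hx => ?_⟩
    rw [mem_insert, not_or] at hx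
    rw [Perm.mul_apply, (mem_colorPreserving.1 hα x).2 hx.2, hfix' κ hκ x hx.1]
  · rintro ⟨α, κ⟩ h ⟨α', κ'⟩ h' heq
    obtain ⟨hα, hκ⟩ := mem_product.1 h
    obtain ⟨hα', hκ'⟩ := mem_product.1 h'
    simp only at heq hα hκ hα' hκ'
    have h1 : κ = κ' := by
      ext x
      by_cases hx : f x = i
      · have := Perm.congr_fun heq x
        rwa [Perm.mul_apply, Perm.mul_apply, hfix α hα x hx, hfix α' hα' x hx] at this
      · rw [hfix' κ hκ x hx, hfix' κ' hκ' x hx]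
    subst h1
    rw [mul_left_cancel heq]
  · intro α hα
    rw [mem_colorPreserving] at hα
    have hp : ∀ x, f (α x) = i ↔ f x = i := fun x => by rw [(hα x).1]
    set κ : Perm E := Perm.ofSubtype (α.subtypePerm (p := fun x => f x = i) hp) with hκdef
    have hκ1 : ∀ x, f x = i → κ x = α x := fun x hx =>
      Perm.ofSubtype_apply_of_mem (p := fun x => f x = i) _ hx
    have hκ2 : ∀ x, f x ≠ i → κ x = x := fun x hx =>
      Perm.ofSubtype_apply_of_not_mem (p := fun x => f x = i) _ hx
    have hκ : κ ∈ permsOn (univ.filter fun x => f x = i) := by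
      rw [mem_permsOn]
      intro x hx
      exact hκ2 x (by simpa using hx)
    refine ⟨⟨κ⁻¹ * α, κ⟩, mem_product.2 ⟨?_, hκ⟩, by simp⟩
    rw [mem_colorPreserving]
    intro x
    refine ⟨by rw [Perm.mul_apply, hpres _ (inv_mem_permsOn hκ), (hα x).1], fun hx => ?_⟩
    rw [Perm.mul_apply, Perm.inv_eq_iff_eq]
    by_cases hxi : f x = i
    · rw [hκ1 x hxi]
    · rw [hκ2 x hxi, (hα x).2]
      rw [mem_insert, not_or]
      exact ⟨hxi, hx⟩

variable [Fintype ι]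

/-- The colorings of `E` with exactly `c i` elements of color `i`. -/
def colorings (E : Type*) [Fintype E] [DecidableEq E] (c : ι → ℕ) : Finset (E → ι) :=
  univ.filter fun f => ∀ i, (univ.filter fun x => f x = i).card = c i

/-- The colorings of `E` with colors in `s` and the root color `r`, such that `c i` elements have
color `i` for all `i ∈ s` and the elements outside `V` have color `r`. -/
def rootedColorings (r : ι) (c : ι → ℕ) (s : Finset ι) (V : Finset E) : Finset (E → ι) :=
  univ.filter fun f => (∀ x, f x ≠ r → x ∈ V) ∧ (∀ x, f x ∈ insert r s) ∧
    ∀ i ∈ s, (univ.filter fun x => f x = i).card = c i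

lemma mem_rootedColorings {r : ι} {c : ι → ℕ} {s : Finset ι} {V : Finset E} {f : E → ι} :
    f ∈ rootedColorings r c s V ↔ (∀ x, f x ≠ r → x ∈ V) ∧ (∀ x, f x ∈ insert r s) ∧
      ∀ i ∈ s, (univ.filter fun x => f x = i).card = c i := by
  simp [rootedColorings]

lemma card_root_add {r : ι} {c : ι → ℕ} {s : Finset ι} {V : Finset E} {f : E → ι} (hr : r ∉ s)
    (hf : f ∈ rootedColorings r c s V) :
    (V.filter fun x => f x = r).card + ∑ i ∈ s, c i = V.card := by
  rw [mem_rootedColorings] at hf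
  obtain ⟨h1, h2, h3⟩ := hf
  rw [card_eq_sum_card_fiberwise (s := V) (f := f) (t := insert r s) fun x _ => h2 x, sum_insert hr]
  congr 1
  refine sum_congr rfl fun i hi => ?_
  rw [← h3 i hi]
  congr 1
  ext x
  simp only [mem_filter, mem_univ, true_and]
  refine ⟨fun h => ⟨h1 x ?_, h⟩, fun h => h.2⟩
  rw [h]
  rintro rfl
  exact hr hi

/-- Introducing the color `i` means recoloring `c i` of the root-colored elements of `V`. -/
lemma sum_rootedColorings_insert {M : Type*} [AddCommMonoid M] {r : ι} {c : ι → ℕ}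
    {s : Finset ι} {i : ι} (hi : i ∉ s) (hir : i ≠ r) (hr : r ∉ s) (V : Finset E)
    (H : (E → ι) → M) :
    ∑ f ∈ rootedColorings r c (insert i s) V, H f =
      ∑ f ∈ rootedColorings r c s V, ∑ X ∈ (V.filter fun x => f x = r).powersetCard (c i),
        H fun x => if x ∈ X then i else f x := by
  have hsi : ∀ j ∈ s, j ≠ i := fun j hj h => hi (h ▸ hj)
  have hsr : ∀ j ∈ s, j ≠ r := fun j hj h => hr (h ▸ hj)
  rw [sum_sigma']
  symm
  refine sum_bij' (fun p _ => fun x => if x ∈ p.2 then i else p.1 x)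
    (fun f _ => ⟨fun x => if f x = i then r else f x, univ.filter fun x => f x = i⟩)
    ?_ ?_ ?_ ?_ ?_
  · rintro ⟨f, X⟩ h
    simp only [mem_sigma, mem_rootedColorings, mem_powersetCard] at h
    obtain ⟨⟨h1, h2, h3⟩, h4, h5⟩ := h
    have hX : ∀ x ∈ X, x ∈ V ∧ f x = r := fun x hx => by simpa using h4 hx
    rw [mem_rootedColorings]
    simp only
    refine ⟨fun x hx => ?_, fun x => ?_, fun j hj => ?_⟩
    · split_ifs at hx with hxX
      · exact (hX x hxX).1
      · exact h1 x hx
    · split_ifs with hxX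
      · simp
      · have := h2 x
        simp only [mem_insert] at this ⊢
        tauto
    · rcases mem_insert.1 hj with rfl | hj
      · rw [← h5]
        congr 1
        ext x
        simp only [mem_filter, mem_univ, true_and]
        split_ifs with hxX
        · simp [hxX]
        · simp only [hxX, iff_false]
          intro hx
          have := h2 x
          rw [hx, mem_insert] at this
          tauto
      · rw [← h3 j hj]
        congr 1
        ext x
        simp only [mem_filter, mem_univ, true_and]
        split_ifs with hxX
        · rw [(hX x hxX).2]
          exact ⟨fun h => absurd h.symm (hsi j hj), fun h => absurd h.symm (hsr j hj)⟩
        · rfl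
  · intro f hf
    rw [mem_rootedColorings] at hf
    obtain ⟨h1, h2, h3⟩ := hf
    simp only [mem_sigma, mem_rootedColorings, mem_powersetCard]
    refine ⟨⟨fun x hx => ?_, fun x => ?_, fun j hj => ?_⟩, fun x hx => ?_, ?_⟩
    · split_ifs at hx with h
      · exact absurd rfl hx
      · exact h1 x hx
    · split_ifs with h
      · simp
      · have := h2 x
        simp only [mem_insert] at this ⊢
        tauto
    · rw [← h3 j (mem_insert_of_mem hj)]
      congr 1
      ext x
      simp only [mem_filter, mem_univ, true_and]
      split_ifs with h
      · rw [h]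
        exact ⟨fun h => absurd h.symm (hsr j hj), fun h => absurd h.symm (hsi j hj)⟩
      · rfl
    · simp only [mem_filter, mem_univ, true_and] at hx ⊢
      exact ⟨h1 x (hx ▸ hir), by simp [hx]⟩
    · exact h3 i (mem_insert_self _ _)
  · rintro ⟨f, X⟩ h
    simp only [mem_sigma, mem_rootedColorings, mem_powersetCard] at h
    obtain ⟨⟨h1, h2, h3⟩, h4, h5⟩ := h
    have hX : ∀ x ∈ X, x ∈ V ∧ f x = r := fun x hx => by simpa using h4 hx
    have hfi : ∀ x, f x ≠ i := fun x hx => by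
      have := h2 x
      rw [hx, mem_insert] at this
      tauto
    have e1 : (fun x => if (if x ∈ X then i else f x) = i then r
        else if x ∈ X then i else f x) = f := by
      ext x
      by_cases hx : x ∈ X
      · simp [hx, (hX x hx).2]
      · simp [hx, hfi x]
    have e2 : (univ.filter fun x => (if x ∈ X then i else f x) = i) = X := by
      ext x
      by_cases hx : x ∈ X
      · simp [hx]
      · simp [hx, hfi x]
    simp only [e1, e2]
  · intro f hf
    ext x
    by_cases hx : f x = i
    · simp [hx]
    · simp [hx]
  · intros
    rfl

/-- The number of pairs of a rooted coloring `f` and a permutation `α` preserving it such that the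
cycles of `α * τ` all meet the set of elements of `V` of the root color. -/
def rootedCount (r : ι) (c : ι → ℕ) (s : Finset ι) (V : Finset E) (τ : Perm E) : ℕ :=
  ∑ f ∈ rootedColorings r c s V,
    ((colorPreserving s f).filter fun α => Meets (α * τ) (V.filter fun x => f x = r)).card

/-- The number of `l`-tuples of distinct elements of `V` whose removal from `V` leaves a set
which meets all the cycles of `τ`. -/
def erasureCount (l : ℕ) (V : Finset E) (τ : Perm E) : ℕ :=
  l ! * ((V.powersetCard l).filter fun W => Meets τ (V \ W)).card

/-- One entry `x` of the tuple is singled out: this double counts pairs of a removable set and one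
of its points. -/
lemma erasureCount_succ (l : ℕ) (V : Finset E) (τ : Perm E) :
    erasureCount (l + 1) V τ = ∑ x ∈ V, erasureCount l (V.erase x) τ := by
  unfold erasureCount
  rw [← mul_sum, Nat.factorial_succ, mul_comm (l + 1), mul_assoc]
  congr 1
  have h1 : (l + 1) * ((V.powersetCard (l + 1)).filter fun W => Meets τ (V \ W)).card =
      ∑ W ∈ (V.powersetCard (l + 1)).filter fun W => Meets τ (V \ W), ∑ _x ∈ W, 1 := by
    simp only [sum_const, smul_eq_mul, mul_one]
    rw [sum_congr rfl fun W hW => (mem_powersetCard.1 (mem_filter.1 hW).1).2, sum_const,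
      smul_eq_mul, mul_comm]
  simp only [card_eq_sum_ones ((powersetCard l _).filter _)]
  rw [h1, sum_sigma', sum_sigma']
  refine sum_bij' (fun p _ => ⟨p.2, p.1.erase p.2⟩) (fun p _ => ⟨insert p.1 p.2, p.1⟩)
    ?_ ?_ ?_ ?_ ?_
  · rintro ⟨W, x⟩ h
    simp only [mem_sigma, mem_filter, mem_powersetCard] at h ⊢
    obtain ⟨⟨⟨h1, h2⟩, h3⟩, h4⟩ := h
    refine ⟨h1 h4, ⟨erase_subset_erase _ h1, by rw [card_erase_of_mem h4, h2]; rfl⟩, ?_⟩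
    rwa [show V.erase x \ W.erase x = V \ W from by
      ext y
      simp only [mem_sdiff, mem_erase]
      constructor
      · tauto
      · rintro ⟨hy1, hy2⟩
        exact ⟨⟨by rintro rfl; exact hy2 h4, hy1⟩, fun h => hy2 h.2⟩]
  · rintro ⟨x, W⟩ h
    simp only [mem_sigma, mem_filter, mem_powersetCard] at h ⊢
    obtain ⟨h1, ⟨h2, h3⟩, h4⟩ := h
    have hxW : x ∉ W := fun h => by simpa using h2 h
    refine ⟨⟨⟨insert_subset h1 (h2.trans (erase_subset _ _)),
      by rw [card_insert_of_notMem hxW, h3]⟩, ?_⟩, mem_insert_self _ _⟩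
    rwa [show V \ insert x W = V.erase x \ W from by
      ext y
      simp only [mem_sdiff, mem_erase, mem_insert]
      tauto]
  · rintro ⟨W, x⟩ h
    simp only [mem_sigma] at h
    simp [insert_erase h.2]
  · rintro ⟨x, W⟩ h
    simp only [mem_sigma, mem_filter, mem_powersetCard] at h
    have hxW : x ∉ W := fun h' => by simpa using h.2.1.1 h'
    simp [erase_insert hxW]
  · intros
    rfl

/-- With the other colors fixed, the class of `i` is a subset of the root-colored part of `V`, whose
size is the same for all colorings. The exchange identity trades that class and its permutation for
one root `x`, which then ceases to be available as a root. -/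
lemma rootedCount_insert {r : ι} {c : ι → ℕ} {s : Finset ι} {i : ι} (hi : i ∉ s) (hir : i ≠ r)
    (hr : r ∉ s) (hc : 1 ≤ c i) (V : Finset E) (τ : Perm E) :
    rootedCount r c (insert i s) V τ =
      (V.card - ∑ j ∈ s, c j - 2).descFactorial (c i - 1) *
        ∑ x ∈ V, rootedCount r c s (V.erase x) τ := by
  have key : ∀ f ∈ rootedColorings r c s V,
      ∑ X ∈ (V.filter fun x => f x = r).powersetCard (c i),
        ((colorPreserving (insert i s) fun x => if x ∈ X then i else f x).filter fun α =>
          Meets (α * τ) (V.filter fun x => (if x ∈ X then i else f x) = r)).card =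
      (V.card - ∑ j ∈ s, c j - 2).descFactorial (c i - 1) *
        ∑ α ∈ colorPreserving s f, ((V.filter fun x => f x = r).filter fun x =>
          Meets (α * τ) ((V.filter fun x => f x = r).erase x)).card := by
    intro f hf
    have hR : V.card - ∑ j ∈ s, c j = (V.filter fun x => f x = r).card := by
      have := card_root_add hr hf
      omega
    rw [hR, mul_sum]
    obtain ⟨h1, h2, h3⟩ := mem_rootedColorings.1 hf
    have hfi : ∀ x, f x ≠ i := fun x hx => by
      have := h2 x
      rw [hx, mem_insert] at this
      tauto
    rw [sum_congr rfl fun α _ => (sum_card_meets_mul (α * τ) _ hc).symm, sum_comm]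
    refine sum_congr rfl fun X hX => ?_
    obtain ⟨hX1, hX2⟩ := mem_powersetCard.1 hX
    have hX' : ∀ x ∈ X, x ∈ V ∧ f x = r := fun x hx => by simpa using hX1 hx
    have e1 : (univ.filter fun x => (if x ∈ X then i else f x) = i) = X := by
      ext x
      by_cases hx : x ∈ X
      · simp [hx]
      · simp [hx, hfi x]
    have e2 : (V.filter fun x => (if x ∈ X then i else f x) = r) =
        (V.filter fun x => f x = r) \ X := by
      ext x
      by_cases hx : x ∈ X
      · simp [hx, hir]
      · simp [hx]
    have e3 : colorPreserving s (fun x => if x ∈ X then i else f x) = colorPreserving s f := by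
      ext α
      simp only [mem_colorPreserving]
      have hr' : ∀ x ∈ X, f x ∉ s := fun x hx => by rwa [(hX' x hx).2]
      constructor
      · intro h x
        obtain ⟨ha, hb⟩ := h x
        by_cases hx : x ∈ X
        · have : α x = x := hb (by simpa [hx] using hi)
          exact ⟨by rw [this], fun _ => this⟩
        · refine ⟨?_, by simpa [hx] using hb⟩
          by_cases hx' : α x ∈ X
          · simp only [hx', hx, if_true, if_false] at ha
            exact absurd ha.symm (hfi x)
          · simpa [hx, hx'] using ha
      · intro h x
        obtain ⟨ha, hb⟩ := h x
        by_cases hx : x ∈ X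
        · have : α x = x := hb (hr' x hx)
          exact ⟨by rw [this], fun _ => this⟩
        · refine ⟨?_, by simpa [hx] using hb⟩
          by_cases hx' : α x ∈ X
          · have : α (α x) = α x := (h (α x)).2 (hr' _ hx')
            rw [α.injective this]
          · simpa [hx, hx'] using ha
    rw [card_filter, sum_colorPreserving_insert hi, e1, e2, e3]
    simp only [← card_filter, mul_assoc]
  unfold rootedCount
  rw [sum_rootedColorings_insert hi hir hr, sum_congr rfl key, ← mul_sum]
  congr 1
  simp only [card_filter (fun x => Meets _ _) (filter _ V), sum_filter]
  rw [sum_congr rfl fun f _ => sum_comm, sum_comm]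
  refine sum_congr rfl fun x hx => ?_
  -- Deleting `x` from `V` forces its color to be the root color, without counting it as a root any
  -- more.
  have e : rootedColorings r c s (V.erase x) = (rootedColorings r c s V).filter fun f => f x = r := by
    ext f
    simp only [mem_filter, mem_rootedColorings, mem_erase]
    constructor
    · rintro ⟨h1, h2⟩
      refine ⟨⟨fun y hy => (h1 y hy).2, h2⟩, ?_⟩
      by_contra h
      exact (h1 x h).1 rfl
    · rintro ⟨⟨h1, h2⟩, h3⟩
      exact ⟨fun y hy => ⟨by rintro rfl; exact hy h3, h1 y hy⟩, h2⟩
  rw [e, sum_filter]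
  refine sum_congr rfl fun f _ => ?_
  split_ifs with h
  · rw [card_filter]
    refine sum_congr rfl fun α _ => ?_
    congr 3
    ext y
    simp only [mem_erase, mem_filter]
    tauto
  · simp

/-- Each color costs one erased point and one falling factorial; these telescope to a ratio of two
factorials, cleared of denominators to stay in `ℕ`. -/
theorem rootedCount_eq {r : ι} {c : ι → ℕ} {s : Finset ι} (hr : r ∉ s) (hc : ∀ i ∈ s, 1 ≤ c i)
    (V : Finset E) (hV : ∑ i ∈ s, c i < V.card) (τ : Perm E) :
    (V.card - ∑ i ∈ s, c i - 1)! * rootedCount r c s V τ =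
      (V.card - s.card - 1)! * erasureCount s.card V τ := by
  induction s using Finset.induction_on generalizing V with
  | empty =>
    have h1 : rootedColorings r c ∅ V = {fun _ => r} := by
      ext f
      simp only [mem_rootedColorings, insert_empty_eq, mem_singleton, notMem_empty]
      constructor
      · intro h
        exact funext h.2.1
      · rintro rfl
        simp
    simp only [rootedCount, h1, sum_singleton, colorPreserving_empty, erasureCount, sum_empty,
      card_empty]
    simp [filter_singleton, apply_ite card]
  | insert i s hi ih =>
    rw [mem_insert, not_or] at hr
    have hci := hc i (mem_insert_self _ _)
    have hc' : ∀ j ∈ s, 1 ≤ c j := fun j hj => hc j (mem_insert_of_mem hj)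
    have hs : s.card ≤ ∑ j ∈ s, c j := by
      simpa using sum_le_sum hc'
    rw [sum_insert hi] at hV ⊢
    rw [rootedCount_insert hi (Ne.symm hr.1) hr.2 hci, card_insert_of_notMem hi,
      erasureCount_succ, mul_sum, mul_sum, mul_sum]
    refine sum_congr rfl fun x hx => ?_
    have hcard := card_erase_of_mem hx
    have h1 := ih hr.2 hc' (V.erase x) (by omega)
    have h2 := Nat.factorial_mul_descFactorial (n := V.card - ∑ j ∈ s, c j - 2) (k := c i - 1)
      (by omega)
    rw [hcard] at h1
    rw [show V.card - (s.card + 1) - 1 = V.card - 1 - s.card - 1 by omega, ← h1, ← mul_assoc]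
    congr 1
    rw [show V.card - (c i + ∑ j ∈ s, c j) - 1 = V.card - ∑ j ∈ s, c j - 2 - (c i - 1) by omega,
      h2]
    congr 1
    omega

/-- The class of `r` is permuted last: it must join all cycles into one, which is possible in `(c r
- 1)!` ways when it meets every cycle, and in none otherwise. What remains is `rootedCount` with all
other colors; the result no longer depends on `c`. -/
theorem sum_card_isFullCycle_mul {c : ι → ℕ} (r : ι) (hc : ∀ i, 1 ≤ c i)
    (hn : ∑ i, c i = Fintype.card E) (σ : Perm E) :
    ∑ f ∈ colorings E c, ((colorPreserving univ f).filter fun α => IsFullCycle (α * σ)).card =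
      (Fintype.card E - Fintype.card ι)! * erasureCount (Fintype.card ι - 1) univ σ := by
  have hr : r ∉ univ.erase r := by simp
  have hins : insert r (univ.erase r) = univ := insert_erase (mem_univ r)
  have hsum : c r + ∑ i ∈ univ.erase r, c i = Fintype.card E := by
    rw [add_sum_erase _ _ (mem_univ r), hn]
  have hcr := hc r
  have h1 : colorings E c = rootedColorings r c (univ.erase r) univ := by
    ext f
    simp only [colorings, mem_filter, mem_univ, true_and]
    constructor
    · intro h
      rw [mem_rootedColorings, hins]
      simp [h]
    · intro h i
      by_cases hi : i = r
      · subst hi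
        have := card_root_add hr h
        rw [card_univ] at this
        omega
      · exact (mem_rootedColorings.1 h).2.2 i (by simpa using hi)
  have hcardι : (univ.erase r).card = Fintype.card ι - 1 := by
    rw [card_erase_of_mem (mem_univ r), card_univ]
  have hι : 0 < Fintype.card ι := Fintype.card_pos_iff.2 ⟨r⟩
  have h2 := rootedCount_eq hr (fun i _ => hc i) (univ : Finset E) (by rw [card_univ]; omega) σ
  rw [card_univ, hcardι,
    show Fintype.card E - (Fintype.card ι - 1) - 1 = Fintype.card E - Fintype.card ι by omega,
    show Fintype.card E - ∑ i ∈ univ.erase r, c i - 1 = c r - 1 by omega] at h2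
  rw [← h2, rootedCount, mul_sum, h1]
  refine sum_congr rfl fun f hf => ?_
  have hcard : (univ.filter fun x => f x = r).card = c r := by
    have := card_root_add hr hf
    rw [card_univ] at this
    omega
  rw [show colorPreserving univ f = colorPreserving (insert r (univ.erase r)) f by rw [hins],
    card_filter, sum_colorPreserving_insert hr, card_filter, mul_sum]
  refine sum_congr rfl fun α _ => ?_
  simp only [mul_assoc]
  rw [← card_filter, card_isFullCycle_mul _ (by rw [← card_pos]; omega), hcard]
  split_ifs <;> simp

end Colorings

/-! ### Colorings of both factors -/

section TwoColorings

variable {E ι : Type*} [Fintype E] [DecidableEq E] [DecidableEq ι]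

lemma sameCycle_congr {f : E → ι} {ρ κ : Perm E} {x u : E} (hκ : ∀ y, f (κ y) = f y)
    (h : ∀ y, f y = f x → ρ y = κ y) : ρ.SameCycle x u ↔ κ.SameCycle x u := by
  have hf : ∀ k : ℕ, f ((κ ^ k) x) = f x := by
    intro k
    induction k with
    | zero => rfl
    | succ k ih => rw [pow_succ', Perm.mul_apply, hκ, ih]
  have hp : ∀ k : ℕ, (ρ ^ k) x = (κ ^ k) x := by
    intro k
    induction k with
    | zero => rfl
    | succ k ih => rw [pow_succ', pow_succ', Perm.mul_apply, Perm.mul_apply, ih, h _ (hf k)]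
  constructor <;> intro hs <;> obtain ⟨k, rfl⟩ := hs.exists_nat_pow_eq
  · rw [hp, Perm.sameCycle_pow_right]
  · rw [← hp, Perm.sameCycle_pow_right]

/-- The color classes are permuted independently, so `card_permsOn_reach` applies to each. -/
lemma card_colorPreserving_reach (f : E → ι) (U : Finset E) (s : Finset ι)
    (hs : ∀ i ∈ s, ∃ x, f x = i) :
    ((colorPreserving s f).filter fun α => ∀ x, f x ∈ s → ∃ u ∈ U, α.SameCycle x u).card =
      ∏ i ∈ s, (U.filter fun x => f x = i).card * ((univ.filter fun x => f x = i).card - 1)! := by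
  induction s using Finset.induction_on with
  | empty => simp [colorPreserving_empty]
  | insert i s hi ih =>
    have hs' : ∀ j ∈ s, ∃ x, f x = j := fun j hj => hs j (mem_insert_of_mem hj)
    obtain ⟨z, hz⟩ := hs i (mem_insert_self _ _)
    rw [prod_insert hi, ← ih hs', card_filter, sum_colorPreserving_insert hi,
      ← card_permsOn_reach (univ.filter fun x => f x = i) (U.filter fun x => f x = i)
        (filter_subset_filter _ (subset_univ U)) ⟨z, by simpa using hz⟩, mul_comm,
      card_filter, sum_mul]
    refine sum_congr rfl fun α hα => ?_
    rw [card_filter, mul_sum]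
    refine sum_congr rfl fun κ hκ => ?_
    rw [mem_colorPreserving] at hα
    have hκ2 : ∀ x, f x ≠ i → κ x = x := fun x hx => mem_permsOn.1 hκ x (by simpa using hx)
    have hκf : ∀ x, f (κ x) = f x := by
      intro x
      by_cases hx : f x = i
      · have := (apply_mem_of_mem_permsOn hκ (x := x)).2 (by simpa using hx)
        rw [hx]
        simpa using this
      · rw [hκ2 x hx]
    have h1 : ∀ x u, f x = i → ((κ * α).SameCycle x u ↔ κ.SameCycle x u) := by
      intro x u hx
      refine sameCycle_congr hκf fun y hy => ?_
      rw [Perm.mul_apply, (hα y).2]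
      rwa [hy, hx]
    have h2 : ∀ x u, f x ∈ s → ((κ * α).SameCycle x u ↔ α.SameCycle x u) := by
      intro x u hx
      refine sameCycle_congr (fun y => (hα y).1) fun y hy => ?_
      rw [Perm.mul_apply, hκ2]
      rw [(hα y).1, hy]
      rintro rfl
      exact hi hx
    have hiff : (∀ x, f x ∈ insert i s → ∃ u ∈ U, (κ * α).SameCycle x u) ↔
        (∀ x, f x ∈ s → ∃ u ∈ U, α.SameCycle x u) ∧
        ∀ x ∈ univ.filter (fun x => f x = i), ∃ u ∈ U.filter (fun x => f x = i),
          κ.SameCycle x u := by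
      constructor
      · intro h
        refine ⟨fun x hx => ?_, fun x hx => ?_⟩
        · obtain ⟨u, hu, hxu⟩ := h x (mem_insert_of_mem hx)
          exact ⟨u, hu, (h2 x u hx).1 hxu⟩
        · have hxi : f x = i := by simpa using hx
          obtain ⟨u, hu, hxu⟩ := h x (by simp [hxi])
          rw [h1 x u hxi] at hxu
          refine ⟨u, mem_filter.2 ⟨hu, ?_⟩, hxu⟩
          obtain ⟨k, rfl⟩ := hxu.exists_nat_pow_eq
          clear hu hxu
          induction k with
          | zero => exact hxi
          | succ k ih => rw [pow_succ', Perm.mul_apply, hκf, ih]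
      · rintro ⟨h3, h4⟩ x hx
        rcases mem_insert.1 hx with hx | hx
        · obtain ⟨u, hu, hxu⟩ := h4 x (by simpa using hx)
          exact ⟨u, (mem_filter.1 hu).1, (h1 x u hx).2 hxu⟩
        · obtain ⟨u, hu, hxu⟩ := h3 x hx
          exact ⟨u, hu, (h2 x u hx).2 hxu⟩
    rw [if_congr hiff rfl rfl, ite_and]
    split_ifs <;> simp

/-- The product counts transversals choosing a point outside `W` in each color class. For a given
transversal, whose points are distinct, `W` is any `l`-subset of the complement. -/
lemma sum_prod_card_sdiff (f : E → ι) (s : Finset ι) (l : ℕ) :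
    ∑ W ∈ (univ : Finset E).powersetCard l, ∏ i ∈ s, ((univ \ W).filter fun x => f x = i).card =
      (∏ i ∈ s, (univ.filter fun x => f x = i).card) *
        (Fintype.card E - s.card).choose l := by
  have h1 : ∀ W : Finset E, ∏ i ∈ s, ((univ \ W).filter fun x => f x = i).card =
      ∑ t ∈ s.pi fun i => univ.filter fun x => f x = i,
        if ∀ i ∈ s.attach, t i i.2 ∉ W then 1 else 0 := by
    intro W
    have h2 : ∀ i ∈ s, ((univ \ W).filter fun x => f x = i).card =
        ∑ x ∈ univ.filter fun x => f x = i, if x ∉ W then 1 else 0 := by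
      intro i _
      rw [← card_filter]
      congr 1
      ext x
      simp
      tauto
    rw [prod_congr rfl h2, prod_sum]
    simp only [prod_ite_zero, prod_const_one]
  simp only [h1]
  rw [sum_comm, ← card_pi, card_eq_sum_ones, sum_mul]
  refine sum_congr rfl fun t ht => ?_
  rw [mem_pi] at ht
  have hcard : (s.attach.image fun i : s => t i.1 i.2).card = s.card := by
    rw [card_image_of_injOn, card_attach]
    intro i _ j _ hij
    have h3 : f (t i i.2) = i := by simpa using ht i i.2
    have h4 : f (t j j.2) = j := by simpa using ht j j.2
    simp only at hij
    rw [hij] at h3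
    exact Subtype.ext (h3.symm.trans h4)
  rw [← card_filter, one_mul, ← hcard, ← card_univ,
    ← card_sdiff_of_subset (subset_univ _), ← card_powersetCard]
  congr 1
  ext W
  simp only [mem_filter, mem_powersetCard, subset_univ, true_and]
  rw [and_comm]
  refine and_congr_left fun _ => ?_
  simp only [subset_iff, mem_sdiff, mem_univ, true_and, mem_image, not_exists, not_and]
  constructor
  · rintro h x hx i hi rfl
    exact h i hi hx
  · intro h i hi hW
    exact h hW i hi rfl

variable [Fintype ι]

lemma colorPreserving_image (f : E → ι) : colorPreserving (univ.image f) f =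
    colorPreserving univ f := by
  ext α
  simp [mem_colorPreserving]

lemma sum_erasureCount (g : E → ι) (l : ℕ) :
    ∑ σ ∈ colorPreserving univ g, erasureCount l univ σ =
      (∏ j, (univ.filter fun x => g x = j).card !) *
        (Fintype.card E - (univ.image g).card).descFactorial l := by
  unfold erasureCount
  simp only [card_filter]
  rw [← mul_sum, sum_comm]
  simp only [← card_filter]
  have h1 : ∀ W ∈ (univ : Finset E).powersetCard l,
      ((colorPreserving univ g).filter fun σ => Meets σ (univ \ W)).card =
        (∏ i ∈ univ.image g, ((univ \ W).filter fun x => g x = i).card) *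
          ∏ i ∈ univ.image g, ((univ.filter fun x => g x = i).card - 1)! := by
    intro W _
    rw [← prod_mul_distrib, ← card_colorPreserving_reach g (univ \ W) (univ.image g) (by simp),
      colorPreserving_image]
    congr 1
    refine filter_congr fun σ _ => ?_
    simp [Meets]
  rw [sum_congr rfl h1, ← sum_mul, sum_prod_card_sdiff, Nat.descFactorial_eq_factorial_mul_choose]
  -- Unused colors contribute `0! = 1`, so the product may run over all colors.
  have h2 : ∏ j, (univ.filter fun x => g x = j).card ! =
      ∏ i ∈ univ.image g, (univ.filter fun x => g x = i).card *
        ((univ.filter fun x => g x = i).card - 1)! := by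
    rw [← prod_subset (subset_univ (univ.image g))]
    · refine prod_congr rfl fun i hi => ?_
      rw [Nat.mul_factorial_pred]
      obtain ⟨x, -, hx⟩ := mem_image.1 hi
      exact (card_pos.2 ⟨x, by simpa using hx⟩).ne'
    · intro i _ hi
      rw [filter_false_of_mem, card_empty, Nat.factorial_zero]
      rintro x - rfl
      exact hi (mem_image_of_mem _ (mem_univ x))
  rw [h2, prod_mul_distrib]
  ring

/-- Compare coefficients in two expansions of the `Fintype.card E`-th power of a sum of variables:
over functions and by the multinomial theorem. -/
lemma prod_factorial_mul_card_colorings {c : ι → ℕ} (hc : ∑ i, c i = Fintype.card E) :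
    (∏ i, (c i)!) * (colorings E c).card = (Fintype.card E)! := by
  rw [← hc, ← Nat.multinomial_spec]
  congr 1
  have h1 := sum_pow_eq_sum_piAntidiag (R := MvPolynomial ι ℕ) univ MvPolynomial.X (Fintype.card E)
  have h2 : (∑ i : ι, (MvPolynomial.X i : MvPolynomial ι ℕ)) ^ Fintype.card E =
      ∑ f : E → ι, ∏ i, MvPolynomial.X i ^ (univ.filter fun x => f x = i).card := by
    rw [← card_univ, ← prod_const, prod_univ_sum, Fintype.piFinset_univ]
    refine sum_congr rfl fun f _ => ?_
    rw [← prod_fiberwise_of_maps_to (s := univ) (t := univ) (g := f) (fun _ _ => mem_univ _)]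
    refine prod_congr rfl fun i _ => ?_
    rw [prod_congr rfl fun x hx => by rw [(mem_filter.1 hx).2], prod_const]
  have h3 : ∀ k : ι → ℕ, (∏ i, MvPolynomial.X i ^ k i : MvPolynomial ι ℕ) =
      MvPolynomial.monomial (Finsupp.equivFunOnFinite.symm k) 1 := by
    intro k
    rw [MvPolynomial.monomial_eq, Finsupp.prod_fintype _ _ (by simp)]
    simp
  rw [h2] at h1
  simp only [h3] at h1
  have h4 := congrArg (MvPolynomial.coeff (Finsupp.equivFunOnFinite.symm c)) h1
  simp only [MvPolynomial.coeff_sum, MvPolynomial.coeff_monomial, ← map_natCast MvPolynomial.C,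
    MvPolynomial.coeff_C_mul, EmbeddingLike.apply_eq_iff_eq, mul_ite, mul_one, mul_zero,
    sum_ite_eq', mem_piAntidiag, hc] at h4
  rw [← card_filter] at h4
  simp only [mem_univ, implies_true, and_self, if_true, Nat.cast_id, ne_eq] at h4
  rw [← h4]
  congr 1
  ext f
  simp [colorings, funext_iff]

/-- The number of factorizations of a full cycle in two factors, the first one colored with
content `c`, and the second one preserving a given coloring `g`. -/
theorem sum_sum_card_isFullCycle {κ : Type*} [DecidableEq κ] [Fintype κ] {c : ι → ℕ} (r : ι)
    (hc : ∀ i, 1 ≤ c i) (hn : ∑ i, c i = Fintype.card E) (g : E → κ) :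
    ∑ σ ∈ colorPreserving univ g, ∑ f ∈ colorings E c,
      ((colorPreserving univ f).filter fun α => IsFullCycle (α * σ)).card =
      (Fintype.card E - Fintype.card ι)! * ((∏ j, (univ.filter fun x => g x = j).card !) *
        (Fintype.card E - (univ.image g).card).descFactorial (Fintype.card ι - 1)) := by
  rw [sum_congr rfl fun σ _ => sum_card_isFullCycle_mul r hc hn σ, ← mul_sum, sum_erasureCount]

end TwoColorings

/-! ### Averaging over the full cycles -/

section Averaging

variable {E : Type*} [Fintype E] [DecidableEq E]

lemma card_isFullCycle [Nonempty E] :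
    (univ.filter fun ζ : Perm E => IsFullCycle ζ).card = (Fintype.card E - 1)! := by
  have h := card_isFullCycle_mul (1 : Perm E) (univ_nonempty (α := E))
  rw [if_pos (show Meets _ _ from fun x => ⟨x, mem_univ x, .rfl⟩), card_univ] at h
  rw [← h]
  congr 1
  ext ζ
  simp [mem_permsOn]

/-! ### Conjugacy of full cycles. -/

lemma IsFullCycle.apply_ne [Nontrivial E] {σ : Perm E} (h : IsFullCycle σ) (x : E) :
    σ x ≠ x := by
  intro hx
  obtain ⟨y, hy⟩ := exists_ne x
  exact hy ((h x y).eq_of_left hx).symm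

lemma IsFullCycle.support [Nontrivial E] {σ : Perm E} (h : IsFullCycle σ) :
    σ.support = univ := by
  ext x
  simpa using h.apply_ne x

lemma IsFullCycle.isCycle [Nontrivial E] {σ : Perm E} (h : IsFullCycle σ) : σ.IsCycle := by
  obtain ⟨x, -⟩ := exists_pair_ne E
  exact ⟨x, h.apply_ne x, fun y _ => h x y⟩

lemma IsFullCycle.exists_conj {σ τ : Perm E} (hσ : IsFullCycle σ) (hτ : IsFullCycle τ) :
    ∃ η : Perm E, η * σ * η⁻¹ = τ := by
  rcases subsingleton_or_nontrivial E with hE | hE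
  · exact ⟨1, Subsingleton.elim _ _⟩
  · rw [← isConj_iff, hσ.isCycle.isConj_iff hτ.isCycle, hσ.support, hτ.support]

lemma IsFullCycle.conj {σ : Perm E} (h : IsFullCycle σ) (η : Perm E) :
    IsFullCycle (η * σ * η⁻¹) := by
  intro x y
  rw [Perm.sameCycle_conj]
  exact h _ _

variable {ι κ : Type*} [Fintype ι] [DecidableEq ι] [Fintype κ] [DecidableEq κ]

lemma card_fiber_comp (f : E → ι) (η : Perm E) (i : ι) :
    (univ.filter fun x => (f ∘ η) x = i).card = (univ.filter fun x => f x = i).card := by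
  refine card_bij' (fun x _ => η x) (fun x _ => η⁻¹ x) ?_ ?_ ?_ ?_ <;> simp

/-- The number of triples `(π, f, g)` where `f` is a coloring of content `c` preserved by `π` and
`g` is a coloring preserved by `π * ζ`, counted with a weight depending on the content of `g`. -/
def coloredCount (c : ι → ℕ) (W : (κ → ℕ) → ℕ) (ζ : Perm E) : ℕ :=
  ∑ π : Perm E, ∑ f ∈ colorings E c, ∑ g : E → κ,
    if (∀ x, f (π x) = f x) ∧ (∀ x, g ((π * ζ) x) = g x)
    then W fun j => (univ.filter fun x => g x = j).card else 0

lemma coloredCount_conj (c : ι → ℕ) (W : (κ → ℕ) → ℕ) (ζ η : Perm E) :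
    coloredCount c W (η * ζ * η⁻¹) = coloredCount c W ζ := by
  unfold coloredCount
  symm
  refine sum_bij' (fun π _ => η * π * η⁻¹) (fun π _ => η⁻¹ * π * η) (by simp) (by simp)
    (by simp [mul_assoc]) (by simp [mul_assoc]) fun π _ => ?_
  refine sum_bij' (fun f _ => f ∘ ⇑(η⁻¹ : Perm E)) (fun f _ => f ∘ ⇑η) ?_ ?_ ?_ ?_ fun f _ => ?_
  · intro f hf
    simp only [colorings, mem_filter, mem_univ, true_and] at hf ⊢
    intro i
    rw [card_fiber_comp, hf]
  · intro f hf
    simp only [colorings, mem_filter, mem_univ, true_and] at hf ⊢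
    intro i
    rw [card_fiber_comp, hf]
  · intros; ext; simp
  · intros; ext; simp
  refine sum_bij' (fun f _ => f ∘ ⇑(η⁻¹ : Perm E)) (fun f _ => f ∘ ⇑η) (by simp) (by simp)
    ?_ ?_ fun g _ => ?_
  · intros; ext; simp
  · intros; ext; simp
  refine if_congr ?_ (by simp only [card_fiber_comp]) rfl
  refine and_congr ?_ ?_
  · rw [← (η⁻¹ : Perm E).forall_congr_right (q := fun x => f (π x) = f x)]
    simp
  · rw [← (η⁻¹ : Perm E).forall_congr_right (q := fun x => g ((π * ζ) x) = g x)]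
    simp

/-- Change of variables `σ = π * ζ`, `α = π⁻¹`, so that `ζ = α * σ`. -/
lemma sum_coloredCount (c : ι → ℕ) (W : (κ → ℕ) → ℕ) :
    ∑ ζ ∈ univ.filter (fun ζ : Perm E => IsFullCycle ζ), coloredCount c W ζ =
      ∑ g : E → κ, (W fun j => (univ.filter fun x => g x = j).card) *
        ∑ σ ∈ colorPreserving univ g, ∑ f ∈ colorings E c,
          ((colorPreserving univ f).filter fun α => IsFullCycle (α * σ)).card := by
  have hr : ∀ g : E → κ, (W fun j => (univ.filter fun x => g x = j).card) *
        ∑ σ ∈ colorPreserving univ g, ∑ f ∈ colorings E c,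
          ((colorPreserving univ f).filter fun α => IsFullCycle (α * σ)).card =
      ∑ σ : Perm E, ∑ f ∈ colorings E c, ∑ α : Perm E,
        if IsFullCycle (α * σ) ∧ (∀ x, f (α x) = f x) ∧ (∀ x, g (σ x) = g x)
        then W fun j => (univ.filter fun x => g x = j).card else 0 := by
    intro g
    rw [mul_sum, colorPreserving, sum_filter]
    refine sum_congr rfl fun σ _ => ?_
    simp only [mem_univ, not_true_eq_false, false_implies, and_true]
    split_ifs with h
    · rw [mul_sum]
      refine sum_congr rfl fun f _ => ?_
      rw [colorPreserving, filter_filter, card_filter, mul_sum]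
      refine sum_congr rfl fun α _ => ?_
      rw [mul_ite, mul_one, mul_zero]
      refine if_congr ?_ rfl rfl
      simp [h, and_comm]
    · simp [h]
  simp only [hr, coloredCount]
  rw [sum_filter]
  have hl : ∀ ζ : Perm E, (if IsFullCycle ζ then ∑ π : Perm E, ∑ f ∈ colorings E c, ∑ g : E → κ,
      (if (∀ x, f (π x) = f x) ∧ (∀ x, g ((π * ζ) x) = g x)
      then W fun j => (univ.filter fun x => g x = j).card else 0) else 0) =
      ∑ g : E → κ, ∑ f ∈ colorings E c, ∑ π : Perm E,
        if IsFullCycle ζ ∧ (∀ x, f (π x) = f x) ∧ (∀ x, g ((π * ζ) x) = g x)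
        then W fun j => (univ.filter fun x => g x = j).card else 0 := by
    intro ζ
    split_ifs with h
    · rw [sum_comm' (t' := colorings E c) (s' := fun _ => univ) (by simp)]
      rw [sum_congr rfl fun f _ => sum_comm, sum_comm]
      simp only [eq_true h, true_and]
    · simp only [eq_false h, false_and, if_false, sum_const_zero]
  rw [sum_congr rfl fun ζ _ => hl ζ, sum_comm]
  refine sum_congr rfl fun g _ => ?_
  rw [sum_comm, sum_comm (s := univ) (t := colorings E c)]
  refine sum_congr rfl fun f _ => ?_
  rw [← sum_product', ← sum_product']
  -- The change of variables is an involution, so the same formula gives its inverse.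
  refine sum_bij' (fun p _ => (p.2 * p.1, p.2⁻¹)) (fun p _ => (p.2 * p.1, p.2⁻¹)) (by simp)
    (by simp) (by simp) (by simp) fun p _ => ?_
  refine if_congr ?_ rfl rfl
  rw [inv_mul_cancel_left]
  refine and_congr Iff.rfl (and_congr ?_ Iff.rfl)
  rw [← p.2.forall_congr_right (q := fun x => f (p.2⁻¹ x) = f x)]
  simp [eq_comm]

/-- The weight `∏ (δ j)!` cancels the denominator of the number of colorings of content `δ`. -/
lemma sum_prod_factorial_mul (H : (κ → ℕ) → ℕ) :
    ∑ g : E → κ, (∏ j, (univ.filter fun x => g x = j).card !) *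
        H (fun j => (univ.filter fun x => g x = j).card) =
      (Fintype.card E)! * ∑ δ ∈ piAntidiag univ (Fintype.card E), H δ := by
  rw [← sum_fiberwise_of_maps_to (s := univ) (t := piAntidiag univ (Fintype.card E))
    (g := fun g : E → κ => fun j => (univ.filter fun x => g x = j).card), mul_sum]
  · refine sum_congr rfl fun δ hδ => ?_
    have hsum : ∑ j, δ j = Fintype.card E := (mem_piAntidiag.1 hδ).1
    rw [← prod_factorial_mul_card_colorings hsum, mul_right_comm, mul_comm _ (card _),
      ← smul_eq_mul, ← sum_const]
    have h1 : (univ.filter fun g : E → κ => (fun j => (univ.filter fun x => g x = j).card) = δ) =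
        colorings E δ := by
      ext g
      simp [colorings, funext_iff]
    rw [h1]
    refine sum_congr rfl fun g hg => ?_
    have h2 : ∀ j, (univ.filter fun x => g x = j).card = δ j := by
      simpa [colorings] using hg
    simp only [h2]
  · intro g _
    simp only [mem_piAntidiag, mem_univ, implies_true, and_true]
    rw [← card_univ, card_eq_sum_card_fiberwise (f := g) (t := univ) (by simp)]

/-- All `(Fintype.card E - 1)!` full cycles are conjugate and contribute equally, so the total over
them is divided by this number; the quotient of factorials leaves the leading factor `Fintype.card
E`. -/
theorem coloredCount_eq [Nonempty E] {c : ι → ℕ} (hc : ∀ i, 1 ≤ c i)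
    (hn : ∑ i, c i = Fintype.card E) (W : (κ → ℕ) → ℕ) {ζ : Perm E} (hζ : IsFullCycle ζ) :
    coloredCount c W ζ = Fintype.card E * (Fintype.card E - Fintype.card ι)! *
      ∑ δ ∈ piAntidiag univ (Fintype.card E), W δ *
        (Fintype.card E - (univ.filter fun j => δ j ≠ 0).card).descFactorial
          (Fintype.card ι - 1) := by
  have hE : 0 < Fintype.card E := Fintype.card_pos
  obtain ⟨r⟩ : Nonempty ι := by
    by_contra h
    rw [not_nonempty_iff] at h
    simp at hn
    omega
  have h1 := sum_coloredCount (E := E) c W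
  have h2 : ∀ ξ ∈ univ.filter (fun ξ : Perm E => IsFullCycle ξ),
      coloredCount c W ξ = coloredCount c W ζ := by
    intro ξ hξ
    obtain ⟨η, rfl⟩ := hζ.exists_conj (mem_filter.1 hξ).2
    exact coloredCount_conj c W ζ η
  rw [sum_congr rfl h2, sum_const, smul_eq_mul, card_isFullCycle] at h1
  simp only [sum_sum_card_isFullCycle r hc hn] at h1
  have h3 := sum_prod_factorial_mul (E := E) fun δ : κ → ℕ => W δ *
        (Fintype.card E - (univ.filter fun j => δ j ≠ 0).card).descFactorial
          (Fintype.card ι - 1)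
  have h4 : ∀ g : E → κ, univ.filter (fun j => (univ.filter fun x => g x = j).card ≠ 0) =
      univ.image g := by
    intro g
    ext j
    simp [filter_eq_empty_iff]
  simp only [h4] at h3
  refine Nat.eq_of_mul_eq_mul_left (Nat.factorial_pos (Fintype.card E - 1)) ?_
  rw [h1, ← mul_assoc, ← mul_assoc, Nat.mul_comm (_ !) (Fintype.card E),
    Nat.mul_factorial_pred hE.ne', mul_right_comm, ← h3, sum_mul]
  refine sum_congr rfl fun g _ => ?_
  ring

end Averaging

/-! ### Sums over weak compositions -/

section WeakCompositions

variable {ι κ : Type*} [Fintype ι] [DecidableEq ι] [Fintype κ] [DecidableEq κ]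

lemma sum_piAntidiag_prod (b : ι → ℕ → ℤ) (n : ℕ) :
    ∑ δ ∈ piAntidiag univ n, ∏ j, b j (δ j) =
      PowerSeries.coeff n (∏ j, PowerSeries.mk (b j)) := by
  rw [PowerSeries.coeff_prod]
  refine sum_bij' (fun δ _ => Finsupp.equivFunOnFinite.symm δ) (fun l _ => l) ?_ ?_ ?_ ?_ ?_
  · intro δ hδ
    rw [mem_piAntidiag] at hδ
    rw [mem_finsuppAntidiag]
    exact ⟨by simpa using hδ.1, by simp⟩
  · intro l hl
    rw [mem_finsuppAntidiag] at hl
    rw [mem_piAntidiag]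
    exact ⟨hl.1, by simp⟩
  · intros; rfl
  · intros; ext; rfl
  · intros; simp

lemma prod_invOneSubPow (s : Finset ι) (d : ι → ℕ) :
    ∏ i ∈ s, (PowerSeries.invOneSubPow ℤ (d i)).val =
      (PowerSeries.invOneSubPow ℤ (∑ i ∈ s, d i)).val := by
  induction s using Finset.induction_on with
  | empty => simp [PowerSeries.invOneSubPow_zero]
  | insert i s hi ih =>
    rw [prod_insert hi, sum_insert hi, PowerSeries.invOneSubPow_add, Units.val_mul, ih]

lemma mk_choose_eq (a : ℕ) : (PowerSeries.mk fun d => ((d.choose a : ℕ) : ℤ)) =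
    PowerSeries.X ^ a * (PowerSeries.invOneSubPow ℤ (a + 1)).val := by
  ext d
  rw [PowerSeries.coeff_mk, PowerSeries.coeff_X_pow_mul',
    PowerSeries.invOneSubPow_val_succ_eq_mk_add_choose, PowerSeries.coeff_mk]
  split_ifs with h
  · rw [Nat.add_sub_cancel' h]
  · rw [Nat.choose_eq_zero_of_lt (by omega), Nat.cast_zero]

lemma mk_iff_ne_zero_eq (p : Prop) [Decidable p] : (PowerSeries.mk fun d : ℕ =>
      if (p ↔ d ≠ 0) then (1 : ℤ) else 0) =
    PowerSeries.X ^ (if p then 1 else 0) *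
      (PowerSeries.invOneSubPow ℤ (if p then 1 else 0)).val := by
  ext d
  rw [PowerSeries.coeff_mk, PowerSeries.coeff_X_pow_mul']
  by_cases hp : p
  · simp only [hp, if_true, true_iff]
    rw [PowerSeries.invOneSubPow_val_succ_eq_mk_add_choose, PowerSeries.coeff_mk]
    simp [Nat.one_le_iff_ne_zero]
  · simp [hp, PowerSeries.invOneSubPow_zero, PowerSeries.coeff_one]

/-- The generating function is `x ^ (a + t) / (1 - x) ^ (a + k + t)` with `a = ∑ i, a i`, `t =
T.card` and `k = Fintype.card ι`; in its coefficient at `x ^ n` the upper index `n + k - 1` is free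
of `a` and `t`. -/
lemma sum_piAntidiag_choose (a : ι → ℕ) (T : Finset κ) {n : ℕ} (hn : 1 ≤ n) :
    ∑ δ ∈ piAntidiag (univ : Finset (ι ⊕ κ)) n, (∏ i, (δ (.inl i)).choose (a i)) *
        (if univ.filter (fun j => δ (.inr j) ≠ 0) = T then 1 else 0) =
      if ∑ i, a i + T.card ≤ n then
        (n + Fintype.card ι - 1).choose (n - ∑ i, a i - T.card) else 0 := by
  have h1 := sum_piAntidiag_prod (Sum.elim (fun i d => ((d.choose (a i) : ℕ) : ℤ))
    (fun (j : κ) d => if (j ∈ T ↔ d ≠ 0) then (1 : ℤ) else 0)) n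
  simp only [Fintype.prod_sum_type, Sum.elim_inl, Sum.elim_inr, mk_choose_eq, mk_iff_ne_zero_eq,
    prod_mul_distrib, prod_invOneSubPow, prod_pow_eq_pow_sum] at h1
  have h2 : ∑ j : κ, (if j ∈ T then 1 else 0) = T.card := by simp
  rw [h2, mul_mul_mul_comm, ← pow_add, ← Units.val_mul, ← PowerSeries.invOneSubPow_add,
    PowerSeries.coeff_X_pow_mul'] at h1
  rw [← Nat.cast_inj (R := ℤ)]
  push_cast
  refine Eq.trans (sum_congr rfl fun δ _ => ?_) (h1.trans ?_)
  · congr 1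
    have h3 : (∀ j ∈ (univ : Finset κ), j ∈ T ↔ δ (.inr j) ≠ 0) ↔
        univ.filter (fun j => δ (.inr j) ≠ 0) = T := by
      simp only [Finset.ext_iff, mem_filter, mem_univ, true_and, true_implies]
      exact forall_congr' fun j => iff_comm
    rw [prod_boole]
    simp only [h3]
  · split_ifs with h
    · rw [sum_add_distrib, sum_const, card_univ, smul_eq_mul, mul_one, ← Nat.sub_sub]
      -- If the exponent of `1 - x` is zero, the series is 1, and `1 ≤ n` makes both sides vanish.
      rcases Nat.eq_zero_or_pos (∑ i, a i + Fintype.card ι + T.card) with h0 | h0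
      · rw [h0, PowerSeries.invOneSubPow_zero, Units.val_one, PowerSeries.coeff_one,
          if_neg (by omega), Nat.choose_eq_zero_of_lt (by omega), Nat.cast_zero]
      · rw [PowerSeries.invOneSubPow_val_eq_mk_sub_one_add_choose_of_pos _ _ h0,
          PowerSeries.coeff_mk, Nat.cast_inj]
        rw [← Nat.choose_symm_of_eq_add]
        · congr 1
          omega
        · omega
    · rfl

/-- Sort by the set `T` of nonzero parts indexed by `κ`. As `a i ≥ 1`, the binomials kill every `δ`
with a zero part indexed by `ι`, so exactly `Fintype.card ι + T.card` parts are nonzero. -/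
theorem sum_piAntidiag_choose_mul (a : ι → ℕ) (ha : ∀ i, 1 ≤ a i) {n : ℕ} (hn : 1 ≤ n)
    (ham : ∑ i, a i ≤ n) (Φ : ℕ → ℕ) :
    ∑ δ ∈ piAntidiag (univ : Finset (ι ⊕ κ)) n, (∏ i, (δ (.inl i)).choose (a i)) *
        Φ (univ.filter fun j => δ j ≠ 0).card =
      ∑ r ∈ range (n - ∑ i, a i + 1), (Fintype.card κ).choose r *
        (n + Fintype.card ι - 1).choose (n - ∑ i, a i - r) * Φ (Fintype.card ι + r) := by
  have h1 : ∀ δ : ι ⊕ κ → ℕ, (∏ i, (δ (.inl i)).choose (a i)) *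
        Φ (univ.filter fun j => δ j ≠ 0).card =
      ∑ T : Finset κ, Φ (Fintype.card ι + T.card) * ((∏ i, (δ (.inl i)).choose (a i)) *
        (if univ.filter (fun j => δ (.inr j) ≠ 0) = T then 1 else 0)) := by
    intro δ
    simp only [mul_ite, mul_one, mul_zero, sum_ite_eq, mem_univ, if_true]
    by_cases h : ∀ i, δ (.inl i) ≠ 0
    · rw [mul_comm]
      congr 2
      rw [card_filter, Fintype.sum_sum_type, ← card_filter, ← card_filter,
        filter_true_of_mem fun i _ => h i, card_univ]
    · push Not at h
      obtain ⟨i, hi⟩ := h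
      have h0 : ∏ i, (δ (.inl i)).choose (a i) = 0 := by
        refine prod_eq_zero (mem_univ i) ?_
        rw [hi]
        exact Nat.choose_eq_zero_of_lt (ha i)
      rw [h0]
      simp
  rw [sum_congr rfl fun δ _ => h1 δ, sum_comm]
  simp only [← mul_sum, sum_piAntidiag_choose a _ hn]
  have h2 := sum_powerset_apply_card (fun t => Φ (Fintype.card ι + t) *
    if ∑ i, a i + t ≤ n then (n + Fintype.card ι - 1).choose (n - ∑ i, a i - t) else 0)
    (x := (univ : Finset κ))
  rw [powerset_univ] at h2
  rw [h2, card_univ]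
  have h3 : ∀ r ∈ range (n - ∑ i, a i + 1), (Fintype.card κ).choose r *
        (n + Fintype.card ι - 1).choose (n - ∑ i, a i - r) * Φ (Fintype.card ι + r) =
      (Fintype.card κ).choose r • (Φ (Fintype.card ι + r) * if ∑ i, a i + r ≤ n then
        (n + Fintype.card ι - 1).choose (n - ∑ i, a i - r) else 0) := by
    intro r hr
    rw [mem_range] at hr
    rw [if_pos (by omega), smul_eq_mul]
    ring
  -- Both ranges of `r` are extended to a common one; each time the added terms are zero.
  rw [sum_congr rfl h3,
    sum_subset (range_mono (Nat.le_max_left (Fintype.card κ + 1) (n - ∑ i, a i + 1))),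
    sum_subset (s₁ := range (n - ∑ i, a i + 1))
      (range_mono (Nat.le_max_right (Fintype.card κ + 1) (n - ∑ i, a i + 1)))]
  · intro r _ hr
    rw [mem_range] at hr
    rw [if_neg (by omega), mul_zero, smul_zero]
  · intro r _ hr
    rw [mem_range] at hr
    rw [Nat.choose_eq_zero_of_lt (by omega), zero_smul]

end WeakCompositions

/-! ### Colorings of cycles -/

section Cycles

variable {E : Type*} [Fintype E] [DecidableEq E]

/-- The set of cycles of `σ`, fixed points included. -/
abbrev Cycles (σ : Perm E) : Type _ := Quotient (Perm.SameCycle.setoid σ)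

/-- The number of elements of a cycle. -/
def cycleCard (σ : Perm E) (q : Cycles σ) : ℕ :=
  (univ.filter fun x => (Quotient.mk (Perm.SameCycle.setoid σ) x) = q).card

lemma mk_eq_mk_iff {σ : Perm E} {x y : E} :
    Quotient.mk (Perm.SameCycle.setoid σ) x = Quotient.mk (Perm.SameCycle.setoid σ) y ↔
      σ.SameCycle x y := Quotient.eq

lemma mk_apply (σ : Perm E) (x : E) :
    Quotient.mk (Perm.SameCycle.setoid σ) (σ x) = Quotient.mk (Perm.SameCycle.setoid σ) x :=
  mk_eq_mk_iff.2 (Perm.sameCycle_apply_left.2 .rfl)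

lemma cycleCard_pos (σ : Perm E) (q : Cycles σ) : 0 < cycleCard σ q :=
  card_pos.2 ⟨q.out, by simp⟩

lemma cycleCard_eq_card_support {σ : Perm E} {q : Cycles σ} (h : σ q.out ≠ q.out) :
    cycleCard σ q = (σ.cycleOf q.out).support.card := by
  unfold cycleCard
  congr 1
  ext x
  rw [Perm.mem_support_cycleOf_iff' h, mem_filter, ← mk_eq_mk_iff, Quotient.out_eq]
  simp [eq_comm]

lemma cycleCard_eq_one {σ : Perm E} {q : Cycles σ} (h : σ q.out = q.out) :
    cycleCard σ q = 1 := by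
  unfold cycleCard
  rw [card_eq_one]
  refine ⟨q.out, ?_⟩
  ext x
  simp only [mem_filter, mem_univ, true_and, mem_singleton]
  constructor
  · rintro hx
    rw [← Quotient.out_eq q, mk_eq_mk_iff] at hx
    exact (hx.symm.eq_of_left h).symm
  · rintro rfl
    exact Quotient.out_eq q

lemma parts_partition_eq_map_cycleCard (σ : Perm E) :
    σ.partition.parts = (univ : Finset (Cycles σ)).val.map (cycleCard σ) := by
  rw [← Multiset.filter_add_not (fun q : Cycles σ => σ q.out ≠ q.out) univ.val, Multiset.map_add]
  have h1 : (Multiset.filter (fun q : Cycles σ => σ q.out ≠ q.out) univ.val).map (cycleCard σ) =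
      σ.cycleType := by
    have hinj : Set.InjOn (fun q : Cycles σ => σ.cycleOf q.out)
        (univ.filter fun q : Cycles σ => σ q.out ≠ q.out) := by
      intro q hq q' hq' h
      have hq : σ q.out ≠ q.out := by simpa using hq
      have h2 : q.out ∈ (σ.cycleOf q.out).support := by
        rw [Perm.mem_support_cycleOf_iff' hq]
      simp only at h
      rw [h] at h2
      have h3 := (Perm.mem_support_cycleOf_iff.1 h2).1
      rw [← Quotient.out_eq q, ← Quotient.out_eq q', mk_eq_mk_iff]
      exact h3.symm
    have himg : (univ.filter fun q : Cycles σ => σ q.out ≠ q.out).image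
        (fun q : Cycles σ => σ.cycleOf q.out) = σ.cycleFactorsFinset := by
      ext c
      simp only [mem_image, mem_filter, mem_univ, true_and]
      constructor
      · rintro ⟨q, hq, rfl⟩
        rw [Perm.cycleOf_mem_cycleFactorsFinset_iff, Perm.mem_support]
        exact hq
      · intro hc
        obtain ⟨x, hx⟩ := (Perm.mem_cycleFactorsFinset_iff.1 hc).1.nonempty_support
        have hcx := Perm.cycle_is_cycleOf hx hc
        set q : Cycles σ := Quotient.mk (Perm.SameCycle.setoid σ) x with hq
        have hqx : σ.SameCycle q.out x := by rw [← mk_eq_mk_iff, Quotient.out_eq, hq]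
        refine ⟨q, ?_, ?_⟩
        · rw [Ne, hqx.apply_eq_self_iff, ← Ne, ← Perm.mem_support]
          exact Perm.mem_cycleFactorsFinset_support_le hc hx
        · rw [hcx]
          exact hqx.cycleOf_eq
    rw [Perm.cycleType_def, ← himg, image_val_of_injOn hinj, Multiset.map_map, filter_val]
    refine Multiset.map_congr rfl fun q hq => ?_
    exact cycleCard_eq_card_support (Multiset.mem_filter.1 hq).2
  have h2 : (Multiset.filter (fun q : Cycles σ => ¬ σ q.out ≠ q.out) univ.val).map (cycleCard σ) =
      Multiset.replicate
        (Multiset.card (Multiset.filter (fun q : Cycles σ => ¬ σ q.out ≠ q.out) univ.val)) 1 := by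
    rw [Multiset.eq_replicate]
    refine ⟨by simp, fun b hb => ?_⟩
    obtain ⟨q, hq, rfl⟩ := Multiset.mem_map.1 hb
    exact cycleCard_eq_one (not_not.1 (Multiset.mem_filter.1 hq).2)
  have h3 : ((univ : Finset (Cycles σ)).val.map (cycleCard σ)).sum = Fintype.card E := by
    rw [← card_univ, card_eq_sum_card_fiberwise (f := Quotient.mk (Perm.SameCycle.setoid σ))
      (t := univ) (by simp)]
    rfl
  rw [← Multiset.filter_add_not (fun q : Cycles σ => σ q.out ≠ q.out) univ.val, Multiset.map_add,
    h1, h2, Multiset.sum_add, Perm.sum_cycleType, Multiset.sum_replicate, smul_eq_mul,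
    mul_one] at h3
  rw [h1, h2, Perm.parts_partition]
  congr 2
  omega

lemma apply_out_eq {ι : Type*} {σ : Perm E} {f : E → ι} (hf : ∀ x, f (σ x) = f x) (x : E) :
    f (Quotient.mk (Perm.SameCycle.setoid σ) x : Cycles σ).out = f x := by
  have h : σ.SameCycle x (Quotient.mk (Perm.SameCycle.setoid σ) x : Cycles σ).out := by
    rw [← mk_eq_mk_iff, Quotient.out_eq]
  obtain ⟨k, hk⟩ := h.exists_nat_pow_eq
  rw [← hk]
  clear hk
  induction k with
  | zero => rfl
  | succ k ih => rw [pow_succ', Perm.mul_apply, hf, ih]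

lemma coeff_psum_eq (R : Type*) [CommRing R] (j : ℕ) (e : ℕ →₀ ℕ) :
    MvPowerSeries.coeff e (psum R j) = if ∃ i : ℕ, e = Finsupp.single i j then 1 else 0 := by
  change psum R j e = _
  unfold psum
  congr

/-- The coefficients of a power symmetric function count the colorings of the cycles of a
permutation. -/
lemma coeff_powerSum (R : Type*) [CommRing R] {n : ℕ} (lam : n.Partition) (σ : Perm E)
    (hσ : σ.partition.parts = lam.parts) (e : ℕ →₀ ℕ) :
    MvPowerSeries.coeff e (powerSum R lam) =
      (((colorings E fun i : e.support => e i).filter fun f => ∀ x, f (σ x) = f x).card : R) := by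
  have h1 : powerSum R lam = ∏ q : Cycles σ, psum R (cycleCard σ q) := by
    rw [powerSum, ← hσ, parts_partition_eq_map_cycleCard, Multiset.map_map]
    rfl
  rw [h1, MvPowerSeries.coeff_prod]
  simp only [coeff_psum_eq, prod_boole, mem_univ, true_implies]
  rw [← natCast_card_filter]
  congr 1
  symm
  have hval : ∀ f ∈ (colorings E fun i : e.support => e i).filter fun f => ∀ x, f (σ x) = f x,
      ∑ q : Cycles σ, Finsupp.single (f q.out : ℕ) (cycleCard σ q) = e := by
    intro f hf
    simp only [colorings, mem_filter, mem_univ, true_and] at hf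
    obtain ⟨hf1, hf2⟩ := hf
    ext i
    rw [Finsupp.finsetSum_apply]
    simp only [Finsupp.single_apply]
    have h2 : (∑ q : Cycles σ, if (f q.out : ℕ) = i then cycleCard σ q else 0) =
        (univ.filter fun x => (f x : ℕ) = i).card := by
      rw [card_eq_sum_card_fiberwise (f := Quotient.mk (Perm.SameCycle.setoid σ))
        (t := univ) (by simp)]
      refine sum_congr rfl fun q _ => ?_
      unfold cycleCard
      rw [filter_filter]
      split_ifs with hq
      · congr 1
        ext x
        simp only [mem_filter, mem_univ, true_and]
        refine ⟨fun h => ⟨?_, h⟩, fun h => h.2⟩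
        rw [← apply_out_eq hf2 x, h, hq]
      · symm
        rw [card_eq_zero, filter_eq_empty_iff]
        rintro x - ⟨h, rfl⟩
        rw [apply_out_eq hf2 x] at hq
        exact hq h
    rw [h2]
    by_cases hi : i ∈ e.support
    · rw [← hf1 ⟨i, hi⟩]
      congr 1
      ext x
      simp [Subtype.ext_iff]
    · rw [Finsupp.notMem_support_iff.1 hi, card_eq_zero, filter_eq_empty_iff]
      rintro x - rfl
      exact hi (f x).2
  -- Expanding the product of power sums picks a variable for each cycle, that is, a color for each
  -- cycle.
  refine card_bij (fun f _ => Finsupp.equivFunOnFinite.symm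
    fun q : Cycles σ => Finsupp.single (f q.out : ℕ) (cycleCard σ q)) ?_ ?_ ?_
  · intro f hf
    rw [mem_filter, mem_finsuppAntidiag]
    refine ⟨⟨by simpa using hval f hf, by simp⟩, fun q => ⟨f q.out, rfl⟩⟩
  · intro f hf f' hf' h
    have h2 := congrFun (Finsupp.equivFunOnFinite.symm.injective h)
    ext x
    have h3 := h2 (Quotient.mk (Perm.SameCycle.setoid σ) x)
    rw [Finsupp.single_left_inj (cycleCard_pos _ _).ne', apply_out_eq (mem_filter.1 hf).2,
      apply_out_eq (mem_filter.1 hf').2] at h3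
    exact h3
  · intro l hl
    rw [mem_filter, mem_finsuppAntidiag] at hl
    obtain ⟨⟨hl1, -⟩, hl2⟩ := hl
    choose i hi using hl2
    have hmem : ∀ q, i q ∈ e.support := by
      intro q
      rw [Finsupp.mem_support_iff, ← hl1, Finsupp.finsetSum_apply]
      refine (lt_of_lt_of_le (cycleCard_pos σ q) ?_).ne'
      refine le_trans ?_ (single_le_sum (f := fun q' => l q' (i q)) (fun _ _ => Nat.zero_le _)
        (mem_univ q))
      simp [hi]
    have hmk : ∀ q : Cycles σ, Quotient.mk (Perm.SameCycle.setoid σ) q.out = q := Quotient.out_eq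
    refine ⟨fun x => ⟨i (Quotient.mk _ x), hmem _⟩, ?_, ?_⟩
    · simp only [colorings, mem_filter, mem_univ, true_and, mk_apply, implies_true, and_true]
      intro j
      refine Eq.trans ?_ (DFunLike.congr_fun hl1 (j : ℕ))
      rw [Finsupp.finsetSum_apply, card_eq_sum_card_fiberwise
        (f := Quotient.mk (Perm.SameCycle.setoid σ)) (t := univ) (by simp)]
      refine sum_congr rfl fun q _ => ?_
      rw [hi q, Finsupp.single_apply, filter_filter]
      split_ifs with hq
      · unfold cycleCard
        congr 1
        ext x
        simp only [mem_filter, mem_univ, true_and, Subtype.ext_iff]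
        exact ⟨fun h => h.2, fun h => ⟨by rw [h, hq], h⟩⟩
      · rw [card_eq_zero, filter_eq_empty_iff]
        rintro x - ⟨h, rfl⟩
        exact hq (Subtype.ext_iff.1 h)
    · ext q : 1
      simp [hi, hmk]

/-- Separated permutations, counted with weight `(k + q) ^ u`, in terms of cycle colorings. -/
lemma card_separated_colorings {n k : ℕ} (A : Fin k → Finset (Fin n)) (σ : Perm (Fin n)) (q : ℕ) :
    (univ.filter fun g : Fin n → Fin k ⊕ Fin q =>
      (∀ x, g (σ x) = g x) ∧ ∀ i, ∀ x ∈ A i, g x = .inl i).card =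
    if IsSeparated A σ then (k + q) ^ freeCycles A σ else 0 := by
  -- `S c` is the set of colors allowed on the cycle `c`: all `k + q` if it meets no `A i`, a single
  -- one if it meets one of them, and none if it meets several.
  set S : Cycles σ → Finset (Fin k ⊕ Fin q) := fun c => univ.filter fun y =>
    ∀ i, ∀ x ∈ A i, Quotient.mk (Perm.SameCycle.setoid σ) x = c → y = .inl i with hS
  have h1 : (univ.filter fun g : Fin n → Fin k ⊕ Fin q =>
      (∀ x, g (σ x) = g x) ∧ ∀ i, ∀ x ∈ A i, g x = .inl i).card = (Fintype.piFinset S).card := by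
    refine card_bij' (fun g _ => fun c => g c.out) (fun h _ => fun x => h (Quotient.mk _ x))
      ?_ ?_ ?_ ?_
    · intro g hg
      simp only [mem_filter, mem_univ, true_and] at hg
      simp only [hS, Fintype.mem_piFinset, mem_filter, mem_univ, true_and]
      rintro c i x hx rfl
      rw [apply_out_eq hg.1, hg.2 i x hx]
    · intro h hh
      simp only [hS, Fintype.mem_piFinset, mem_filter, mem_univ, true_and] at hh ⊢
      exact ⟨fun x => by rw [mk_apply], fun i x hx => hh _ i x hx rfl⟩
    · intro g hg
      simp only [mem_filter, mem_univ, true_and] at hg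
      ext x : 1
      exact apply_out_eq hg.1 x
    · intro h _
      ext c : 1
      exact congrArg h (Quotient.out_eq c)
  rw [h1, Fintype.card_piFinset]
  set free : Cycles σ → Prop := fun c =>
    ∀ x, Quotient.mk (Perm.SameCycle.setoid σ) x = c → ∀ i, x ∉ A i with hfree
  have hSfree : ∀ c, free c → (S c).card = k + q := by
    intro c hc
    rw [hS]
    simp only
    rw [filter_true_of_mem, card_univ, Fintype.card_sum, Fintype.card_fin, Fintype.card_fin]
    intro y _ i x hx hxc
    exact absurd hx (hc x hxc i)
  split_ifs with hsep
  · have hSn : ∀ c, ¬ free c → (S c).card = 1 := by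
      intro c hc
      simp only [hfree, not_forall, not_not] at hc
      obtain ⟨x, hxc, i, hx⟩ := hc
      rw [card_eq_one]
      refine ⟨.inl i, ?_⟩
      ext y
      simp only [hS, mem_filter, mem_univ, true_and, mem_singleton]
      constructor
      · intro h
        exact h i x hx hxc
      · rintro rfl j z hz hzc
        by_contra hij
        refine hsep i j (fun h => hij (by rw [h])) x hx z hz ?_
        rw [← mk_eq_mk_iff, hxc, hzc]
    have h2 : ∀ c, (S c).card = if free c then k + q else 1 := by
      intro c
      split_ifs with h
      · exact hSfree c h
      · exact hSn c h
    rw [prod_congr rfl fun c _ => h2 c, prod_ite, prod_const, prod_const_one, mul_one]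
    congr 1
    rw [freeCycles, Nat.card_eq_fintype_card, Fintype.card_subtype]
  · simp only [IsSeparated, not_forall, not_not] at hsep
    obtain ⟨i, j, hij, a, ha, b, hb, hab⟩ := hsep
    refine prod_eq_zero (mem_univ (Quotient.mk (Perm.SameCycle.setoid σ) a)) ?_
    rw [card_eq_zero, filter_eq_empty_iff]
    intro y _ h
    have h3 := h i a ha rfl
    have h4 := h j b hb (mk_eq_mk_iff.2 hab.symm)
    rw [h3] at h4
    exact hij (Sum.inl_injective h4)

/-- Each `A i` is chosen inside its own color class, so disjointness is automatic. -/
lemma card_tuples_compatible {n m q : ℕ} (α : Composition m)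
    (g : Fin n → Fin α.length ⊕ Fin q) :
    ((tuples n α).filter fun A => ∀ i, ∀ x ∈ A i, g x = .inl i).card =
      ∏ i, (univ.filter fun x => g x = .inl i).card.choose (α.blocksFun i) := by
  rw [prod_congr rfl fun i _ => (card_powersetCard (α.blocksFun i)
    (univ.filter fun x => g x = .inl i)).symm, ← Fintype.card_piFinset]
  congr 1
  ext A
  simp only [tuples, mem_filter, mem_univ, true_and, Fintype.mem_piFinset, mem_powersetCard]
  constructor
  · rintro ⟨⟨h1, h2⟩, h3⟩ i
    exact ⟨fun x hx => by simpa using h3 i x hx, h1 i⟩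
  · intro h
    have h1 : ∀ i, ∀ x ∈ A i, g x = .inl i := fun i x hx => by simpa using (h i).1 hx
    refine ⟨⟨fun i => (h i).2, fun i j hij => ?_⟩, h1⟩
    rw [Finset.disjoint_left]
    intro x hx hx'
    have := h1 j x hx'
    rw [h1 i x hx] at this
    exact hij (Sum.inl_injective this)

end Cycles

/-! ### The generating function of separated pairs -/

section GeneratingFunction

lemma isFullCycle_finRotate (n : ℕ) : IsFullCycle (finRotate n) := by
  rcases n with _ | _ | n
  · intro x
    exact x.elim0
  · have : Subsingleton (Fin (0 + 1)) := inferInstanceAs (Subsingleton (Fin 1))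
    intro x y
    rw [Subsingleton.elim x y]
  · intro x y
    exact isCycle_finRotate.sameCycle (by simp) (by simp)

lemma sum_sum_permsOfType {M : Type*} [AddCommMonoid M] {n : ℕ} (F : Perm (Fin n) → M) :
    ∑ lam : n.Partition, ∑ π ∈ permsOfType lam, F π = ∑ π, F π := by
  simp only [permsOfType, sum_filter]
  rw [sum_comm]
  refine sum_congr rfl fun π _ => ?_
  rw [sum_eq_single (⟨π.partition.parts, π.partition.parts_pos,
    by rw [π.partition.parts_sum, Fintype.card_fin]⟩ : n.Partition)]
  · simp
  · intro lam _ h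
    rw [if_neg]
    intro h'
    exact h (Nat.Partition.ext h'.symm)
  · simp

variable {n m : ℕ} (α : Composition m)

/-- At `t = q` the shifted base is `α.length + q`: one reserved color for each `A i` and `q` free
ones. Exchanging the sums over tuples and colorings `g` gives the binomial weight. -/
lemma eval_coeff_shiftT_genFun (e : ℕ →₀ ℕ) (q : ℕ) :
    (MvPowerSeries.coeff e (shiftT α.length (genFun n α))).eval (q : ℚ) =
      (coloredCount (fun i : e.support => e i) (fun δ : Fin α.length ⊕ Fin q → ℕ =>
        ∏ i, (δ (.inl i)).choose (α.blocksFun i)) (finRotate n) : ℚ) := by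
  have h1 : ∀ lam : n.Partition, ((MvPowerSeries.coeff e ((∑ x ∈ sepPairs lam α,
      (Polynomial.X : Polynomial ℚ) ^ freeCycles x.2 (x.1 * finRotate n)) •
        powerSum (Polynomial ℚ) lam)).comp
          (Polynomial.X + Polynomial.C (α.length : ℚ))).eval (q : ℚ) =
      ((∑ π ∈ permsOfType lam, ((colorings (Fin n) fun i : e.support => e i).filter
        fun f => ∀ x, f (π x) = f x).card * ∑ A ∈ tuples n α,
        if IsSeparated A (π * finRotate n)
        then (α.length + q) ^ freeCycles A (π * finRotate n) else 0 : ℕ) : ℚ) := by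
    intro lam
    rw [MvPowerSeries.coeff_smul, sum_mul, Polynomial.eval_comp,
      Polynomial.eval_finsetSum, Nat.cast_sum, sepPairs, sum_filter, sum_product]
    refine sum_congr rfl fun π hπ => ?_
    rw [coeff_powerSum _ lam π (by simpa [permsOfType] using hπ), Nat.cast_mul, Nat.cast_sum,
      mul_sum]
    refine sum_congr rfl fun A _ => ?_
    split_ifs
    · simp only [Polynomial.eval_mul, Polynomial.eval_pow, Polynomial.eval_add,
        Polynomial.eval_X, Polynomial.eval_C, Polynomial.eval_natCast]
      push_cast
      rw [mul_comm, add_comm]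
      congr
    · simp
  have h2 : (MvPowerSeries.coeff e (shiftT α.length (genFun n α))).eval (q : ℚ) =
      ((∑ π : Perm (Fin n), ((colorings (Fin n) fun i : e.support => e i).filter
        fun f => ∀ x, f (π x) = f x).card * ∑ A ∈ tuples n α,
        if IsSeparated A (π * finRotate n)
        then (α.length + q) ^ freeCycles A (π * finRotate n) else 0 : ℕ) : ℚ) := by
    rw [← sum_sum_permsOfType, Nat.cast_sum, ← sum_congr rfl fun lam _ => h1 lam,
      shiftT, MvPowerSeries.coeff_map, genFun, map_sum, map_sum, Polynomial.eval_finsetSum]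
    rfl
  rw [h2, Nat.cast_inj, coloredCount]
  refine sum_congr rfl fun π _ => ?_
  rw [card_filter, sum_mul]
  refine sum_congr rfl fun f _ => ?_
  rw [sum_congr rfl fun A _ => (card_separated_colorings A (π * finRotate n) q).symm]
  split_ifs with hf
  · rw [one_mul, sum_congr rfl fun A _ => card_filter _ _, sum_comm]
    refine sum_congr rfl fun g _ => ?_
    simp only [hf, true_and, implies_true]
    split_ifs with hg
    · simp only [hg, true_and, implies_true]
      rw [← card_filter, card_tuples_compatible]
    · simp only [eq_false hg, false_and, if_false, sum_const_zero]
  · simp [hf]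

lemma eval_binomPoly (r q : ℕ) : (binomPoly r).eval (q : ℚ) = (q.choose r : ℚ) := by
  have h : ∏ i ∈ range r, ((q : ℚ) - i) = q.descFactorial r := by
    induction r with
    | zero => simp
    | succ r ih =>
      rw [prod_range_succ, ih, Nat.descFactorial_succ, Nat.cast_mul, mul_comm]
      rcases le_or_gt r q with hr | hr
      · rw [Nat.cast_sub hr]
      · rw [Nat.descFactorial_of_lt hr]
        simp
  rw [binomPoly, Polynomial.eval_mul, Polynomial.eval_C, Polynomial.eval_prod]
  simp only [Polynomial.eval_sub, Polynomial.eval_X, Polynomial.eval_C, h]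
  rw [Nat.descFactorial_eq_factorial_mul_choose, Nat.cast_mul, inv_mul_cancel_left₀]
  exact_mod_cast r.factorial_ne_zero

lemma coeff_monomialSym (R : Type*) [CommRing R] (lam : n.Partition) (e : ℕ →₀ ℕ) :
    MvPowerSeries.coeff e (monomialSym R lam) =
      if e.support.val.map e = lam.parts then 1 else 0 := by
  change monomialSym R lam e = _
  unfold monomialSym
  congr

theorem shiftT_genFun (hn : 1 ≤ n) (hmn : m ≤ n) :
    shiftT α.length (genFun n α) =
      ∑ r ∈ range (n - m + 1),
        (binomPoly r * Polynomial.C (((n + α.length - 1).choose (n - m - r) : ℕ) : ℚ)) •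
        ∑ lam : n.Partition with lam.parts.card ≤ n - α.length - r + 1,
          Polynomial.C
            (((n * (n - lam.parts.card)! * (n - α.length - r)! : ℕ) : ℚ) /
              ((n - α.length - r + 1 - lam.parts.card)! : ℕ)) •
          monomialSym (Polynomial ℚ) lam := by
  have : Nonempty (Fin n) := ⟨⟨0, hn⟩⟩
  ext1 e
  -- Polynomials in `t` that agree at all natural numbers are equal.
  refine Polynomial.eq_of_infinite_eval_eq _ _
    (Set.infinite_of_injective_forall_mem (f := fun q : ℕ => (q : ℚ)) Nat.cast_injective
      fun q => ?_)
  rw [Set.mem_ofPred_eq, eval_coeff_shiftT_genFun, map_sum, Polynomial.eval_finsetSum]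
  simp only [MvPowerSeries.coeff_smul, map_sum, Polynomial.eval_mul,
    Polynomial.eval_finsetSum, Polynomial.eval_C, eval_binomPoly, coeff_monomialSym]
  by_cases hdeg : ∑ i : e.support, e i = n
  · have hsupp : Fintype.card e.support = e.support.card := Fintype.card_coe _
    have hpos : 0 < e.support.card := by
      rw [card_pos, nonempty_iff_ne_empty]
      intro h
      have : IsEmpty e.support := isEmpty_coe_sort.2 h
      simp at hdeg
      omega
    have hle : e.support.card ≤ n := by
      rw [← hsupp, ← hdeg, ← card_univ, card_eq_sum_ones]
      exact sum_le_sum fun i _ => Nat.one_le_iff_ne_zero.2 (Finsupp.mem_support_iff.1 i.2)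
    rw [coloredCount_eq (fun i => Nat.one_le_iff_ne_zero.2 (Finsupp.mem_support_iff.1 i.2))
      (by rw [hdeg, Fintype.card_fin]) _ (isFullCycle_finRotate n), Fintype.card_fin,
      sum_piAntidiag_choose_mul α.blocksFun (fun i => α.one_le_blocksFun i) hn
        (by rwa [α.sum_blocksFun]) (fun t => (n - t).descFactorial
          (Fintype.card e.support - 1)), α.sum_blocksFun, Fintype.card_fin, Fintype.card_fin,
      mul_sum, Nat.cast_sum]
    refine sum_congr rfl fun r hr => ?_
    have hlam : ∃ lam : n.Partition, e.support.val.map e = lam.parts :=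
      ⟨⟨e.support.val.map e, fun {i} hi => by
        obtain ⟨j, hj, rfl⟩ := Multiset.mem_map.1 hi
        exact Nat.pos_of_ne_zero (Finsupp.mem_support_iff.1 hj), by
        rw [← hdeg]
        exact (sum_coe_sort e.support e).symm⟩, rfl⟩
    obtain ⟨lam, hlam⟩ := hlam
    have hcard : lam.parts.card = e.support.card := by
      rw [← hlam]
      simp
    rw [sum_filter, sum_eq_single lam]
    · rw [hsupp, if_pos hlam, Polynomial.eval_one, mul_one, hcard, mem_range] at *
      have hkm := α.length_le
      -- The bound on the number of parts is where the falling factorial becomes zero; within it,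
      -- that falling factorial is the quotient of factorials.
      split_ifs with hc
      · rw [← Nat.sub_sub, ← Nat.factorial_mul_descFactorial
          (show e.support.card - 1 ≤ n - α.length - r by omega),
          show n - α.length - r - (e.support.card - 1) =
            n - α.length - r + 1 - e.support.card by omega]
        have : ((n - α.length - r + 1 - e.support.card)! : ℚ) ≠ 0 := by
          exact_mod_cast Nat.factorial_ne_zero _
        push_cast
        field_simp
      · rw [Nat.descFactorial_of_lt (by omega)]
        simp
    · intro mu _ hmu
      rw [if_neg (fun h : e.support.val.map e = mu.parts =>
        hmu (Nat.Partition.ext (h.symm.trans hlam)))]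
      simp
    · simp
  · have h1 : colorings (Fin n) (fun i : e.support => e i) = ∅ := by
      rw [colorings, filter_eq_empty_iff]
      intro f _ hf
      apply hdeg
      rw [← sum_congr rfl fun i _ => hf i, ← card_eq_sum_card_fiberwise (by simp), card_univ,
        Fintype.card_fin]
    have h2 : ∀ lam : n.Partition, e.support.val.map e ≠ lam.parts := by
      intro lam h
      apply hdeg
      rw [← lam.parts_sum, ← h]
      exact sum_coe_sort e.support e
    simp [coloredCount, h1, h2]

end GeneratingFunction

/-! ### Consequences for the separation probabilities -/

section Separation

lemma shiftT_injective (k : ℕ) : Function.Injective (shiftT k) := by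
  intro F G h
  ext1 e
  have h1 := congrArg (MvPowerSeries.coeff e) h
  simp only [shiftT, MvPowerSeries.coeff_map, Polynomial.coe_compRingHom_apply] at h1
  refine Polynomial.funext fun x => ?_
  have h2 := congrArg (Polynomial.eval (x - k)) h1
  simpa [Polynomial.eval_comp] using h2

lemma genFun_eq_of_length_eq {n m : ℕ} (hn : 1 ≤ n) (hmn : m ≤ n) {α β : Composition m}
    (h : β.length = α.length) : genFun n β = genFun n α := by
  refine shiftT_injective α.length ?_
  have h1 := shiftT_genFun β hn hmn
  rw [h] at h1
  rw [h1, shiftT_genFun α hn hmn]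

lemma map_psum {R S : Type*} [CommRing R] [CommRing S] (T : R →+* S) (j : ℕ) :
    MvPowerSeries.map T (psum R j) = psum S j := by
  ext e
  rw [MvPowerSeries.coeff_map, coeff_psum_eq, coeff_psum_eq]
  split_ifs <;> simp

lemma map_powerSum {R S : Type*} [CommRing R] [CommRing S] (T : R →+* S) {n : ℕ}
    (lam : n.Partition) : MvPowerSeries.map T (powerSum R lam) = powerSum S lam := by
  rw [powerSum, powerSum, map_multiset_prod, Multiset.map_map]
  simp [map_psum]

lemma evalT_one_genFun {n m : ℕ} (α : Composition m) :
    evalT 1 (genFun n α) =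
      ∑ lam : n.Partition, ((sepPairs lam α).card : ℚ) • powerSum ℚ lam := by
  rw [genFun, map_sum]
  refine sum_congr rfl fun lam _ => ?_
  ext e
  rw [evalT, MvPowerSeries.coeff_map, MvPowerSeries.coeff_smul, map_mul,
    MvPowerSeries.coeff_smul, ← map_powerSum (Polynomial.evalRingHom (1 : ℚ)) lam,
    MvPowerSeries.coeff_map]
  simp

lemma powerSumCoeff_sum {n : ℕ} (a : n.Partition → ℚ) (lam : n.Partition) :
    powerSumCoeff lam (∑ mu : n.Partition, a mu • powerSum ℚ mu) = a lam := by
  set l : (Σ n : ℕ, n.Partition) →₀ ℚ := ∑ mu : n.Partition, Finsupp.single ⟨n, mu⟩ (a mu) with hl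
  have h1 : Finsupp.linearCombination ℚ (fun mu : Σ n : ℕ, n.Partition => powerSum ℚ mu.2) l =
      ∑ mu : n.Partition, a mu • powerSum ℚ mu := by
    rw [hl, map_sum]
    simp
  have h2 : ∑ mu : n.Partition, a mu • powerSum ℚ mu ∈
      Submodule.span ℚ (Set.range fun mu : Σ n : ℕ, n.Partition => powerSum ℚ mu.2) :=
    Submodule.sum_mem _ fun mu _ => Submodule.smul_mem _ _ (Submodule.subset_span ⟨⟨n, mu⟩, rfl⟩)
  rw [powerSumCoeff, dif_pos h2, linearIndependent_powerSum.repr_eq h1, hl,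
    Finsupp.finsetSum_apply, sum_eq_single lam]
  · simp
  · intro mu _ h
    rw [Finsupp.single_apply, if_neg]
    simpa using h
  · simp

lemma isFullCycle_iff_partition {n : ℕ} (hn : 1 ≤ n) (σ : Perm (Fin n)) :
    IsFullCycle σ ↔ σ.partition.parts = (Nat.Partition.indiscrete n).parts := by
  have hcard : Multiset.card σ.partition.parts = Fintype.card (Cycles σ) := by
    rw [parts_partition_eq_map_cycleCard, Multiset.card_map]
    rfl
  rw [Nat.Partition.indiscrete_parts (by omega)]
  constructor
  · intro h
    have h1 : Fintype.card (Cycles σ) = 1 := by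
      rw [Fintype.card_eq_one_iff]
      refine ⟨Quotient.mk _ ⟨0, hn⟩, fun q => ?_⟩
      rw [← Quotient.out_eq q, mk_eq_mk_iff]
      exact h _ _
    rw [h1, Multiset.card_eq_one] at hcard
    obtain ⟨b, hb⟩ := hcard
    have h2 := σ.partition.parts_sum
    rw [hb, Multiset.sum_singleton, Fintype.card_fin] at h2
    rw [hb, h2]
  · intro h
    rw [h, Multiset.card_singleton] at hcard
    obtain ⟨c, hc⟩ := Fintype.card_eq_one_iff.1 hcard.symm
    intro x y
    rw [← mk_eq_mk_iff, hc (Quotient.mk _ x), hc (Quotient.mk _ y)]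

/-! ### Conjugation invariance and the count of tuples. -/

lemma mem_permsOfType {n : ℕ} {lam : n.Partition} {π : Perm (Fin n)} :
    π ∈ permsOfType lam ↔ π.partition.parts = lam.parts := by
  simp [permsOfType]

lemma conj_mem_permsOfType {n : ℕ} {lam : n.Partition} {π : Perm (Fin n)} (η : Perm (Fin n)) :
    η * π * η⁻¹ ∈ permsOfType lam ↔ π ∈ permsOfType lam := by
  rw [mem_permsOfType, mem_permsOfType,
    ← Perm.partition_eq_of_isConj.1 (isConj_iff.2 ⟨η, rfl⟩)]

lemma isSeparated_map_conj {n k : ℕ} (A : Fin k → Finset (Fin n)) (σ η : Perm (Fin n)) :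
    IsSeparated (fun i => (A i).map η.toEmbedding) (η * σ * η⁻¹) ↔ IsSeparated A σ := by
  unfold IsSeparated
  refine forall_congr' fun i => forall_congr' fun j => imp_congr_right fun _ => ?_
  constructor
  · intro h a ha b hb hs
    exact h (η a) (mem_map_of_mem _ ha) (η b) (mem_map_of_mem _ hb) hs.conj
  · intro h a ha b hb hs
    rw [mem_map_equiv] at ha hb
    rw [Perm.sameCycle_conj] at hs
    exact h _ ha _ hb hs

/-- The coloring content attached to a composition of `m`: the parts of the composition, and the
number `n - m` of remaining elements. -/
def contentOf (n : ℕ) {m : ℕ} (α : Composition m) : Option (Fin α.length) → ℕ :=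
  fun i => i.elim (n - m) α.blocksFun

variable {n m : ℕ} {α : Composition m}

lemma tuple_of_mem_colorings {f : Fin n → Option (Fin α.length)}
    (hf : f ∈ colorings (Fin n) (contentOf n α)) :
    (fun i => univ.filter fun x => f x = some i) ∈ tuples n α := by
  simp only [colorings, tuples, mem_filter, mem_univ, true_and] at hf ⊢
  refine ⟨fun i => hf (some i), fun i j hij => ?_⟩
  rw [Finset.disjoint_left]
  simp only [mem_filter, mem_univ, true_and]
  intro x hx hx'
  rw [hx] at hx'
  exact hij (Option.some_injective _ hx')

lemma exists_coloring_of_mem_tuples (hmn : m ≤ n) {A : Fin α.length → Finset (Fin n)}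
    (hA : A ∈ tuples n α) : ∃ f ∈ colorings (Fin n) (contentOf n α),
      (fun i => univ.filter fun x => f x = some i) = A := by
  simp only [tuples, mem_filter, mem_univ, true_and] at hA
  obtain ⟨hA1, hA2⟩ := hA
  set f : Fin n → Option (Fin α.length) :=
    fun x => if h : ∃ i, x ∈ A i then some h.choose else none with hf
  have h1 : ∀ x i, f x = some i ↔ x ∈ A i := by
    intro x i
    simp only [hf]
    split_ifs with h
    · rw [Option.some_inj]
      constructor
      · intro h'
        rw [← h']
        exact h.choose_spec
      · intro hx
        by_contra hne
        exact Finset.disjoint_left.1 (hA2 _ _ hne) h.choose_spec hx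
    · simp only [false_iff]
      exact fun hx => h ⟨i, hx⟩
  have h2 : (fun i => univ.filter fun x => f x = some i) = A := by
    ext i x
    simp [h1]
  refine ⟨f, ?_, h2⟩
  have h3 : ∀ i, (univ.filter fun x => f x = some i).card = α.blocksFun i := by
    intro i
    rw [← hA1, ← h2]
  simp only [colorings, mem_filter, mem_univ, true_and]
  rintro (_ | i)
  · have h4 := card_eq_sum_card_fiberwise (s := univ) (f := f) (t := univ) (by simp)
    rw [card_univ, Fintype.card_fin, Fintype.sum_option, sum_congr rfl fun i _ => h3 i,
      α.sum_blocksFun] at h4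
    simp only [contentOf, Option.elim_none]
    omega
  · exact h3 i

/-- A tuple is a coloring in which `none` marks the points in no `A i`, so the multinomial count
applies. -/
lemma card_tuples (hmn : m ≤ n) :
    (n - m)! * (∏ i, (α.blocksFun i)!) * (tuples n α).card = n ! := by
  have h1 : (tuples n α).card = (colorings (Fin n) (contentOf n α)).card := by
    symm
    refine card_bij (fun f _ => fun i => univ.filter fun x => f x = some i)
      (fun f hf => tuple_of_mem_colorings hf) ?_ ?_
    · intro f _ g _ h
      have h2 : ∀ x i, f x = some i ↔ g x = some i := by
        intro x i
        have h3 := Finset.ext_iff.1 (congrFun h i) x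
        simpa using h3
      ext x i
      exact h2 x i
    · intro A hA
      obtain ⟨f, hf, h⟩ := exists_coloring_of_mem_tuples hmn hA
      exact ⟨f, hf, h⟩
  have h2 := prod_factorial_mul_card_colorings (E := Fin n) (c := contentOf n α)
    (by simp [Fintype.sum_option, contentOf, α.sum_blocksFun, hmn])
  rw [Fintype.prod_option, Fintype.card_fin] at h2
  rw [h1]
  exact h2

lemma exists_perm_comp_eq {E ι : Type*} [Fintype E] [DecidableEq E] [Fintype ι] [DecidableEq ι]
    {c : ι → ℕ} {f g : E → ι} (hf : f ∈ colorings E c) (hg : g ∈ colorings E c) :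
    ∃ η : Perm E, ∀ x, g (η x) = f x := by
  simp only [colorings, mem_filter, mem_univ, true_and] at hf hg
  have h : ∀ i, Nonempty ({x // f x = i} ≃ {x // g x = i}) := by
    intro i
    rw [← Fintype.card_eq, Fintype.card_subtype, Fintype.card_subtype, hf, hg]
  exact ⟨Equiv.ofFiberEquiv fun i => (h i).some, fun x => Equiv.ofFiberEquiv_map _ x⟩

lemma exists_perm_map_eq (hmn : m ≤ n) {A B : Fin α.length → Finset (Fin n)}
    (hA : A ∈ tuples n α) (hB : B ∈ tuples n α) :
    ∃ η : Perm (Fin n), (fun i => (A i).map η.toEmbedding) = B := by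
  obtain ⟨f, hf, rfl⟩ := exists_coloring_of_mem_tuples hmn hA
  obtain ⟨g, hg, rfl⟩ := exists_coloring_of_mem_tuples hmn hB
  obtain ⟨η, hη⟩ := exists_perm_comp_eq hf hg
  refine ⟨η, ?_⟩
  ext i x
  rw [mem_map_equiv]
  simp [← hη]

lemma map_mem_tuples {A : Fin α.length → Finset (Fin n)} (η : Perm (Fin n)) :
    (fun i => (A i).map η.toEmbedding) ∈ tuples n α ↔ A ∈ tuples n α := by
  simp [tuples, Finset.disjoint_map]

/-- Conjugate both factors by a permutation carrying `A` to `B`. -/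
lemma card_pairs_eq (hmn : m ≤ n) (lam mu : n.Partition) {A B : Fin α.length → Finset (Fin n)}
    (hA : A ∈ tuples n α) (hB : B ∈ tuples n α) :
    ((permsOfType lam ×ˢ permsOfType mu).filter fun x => IsSeparated A (x.1 * x.2)).card =
      ((permsOfType lam ×ˢ permsOfType mu).filter fun x => IsSeparated B (x.1 * x.2)).card := by
  obtain ⟨η, rfl⟩ := exists_perm_map_eq hmn hA hB
  have h : ∀ p q : Perm (Fin n), η * p * η⁻¹ * (η * q * η⁻¹) = η * (p * q) * η⁻¹ := by
    intros; simp [mul_assoc]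
  refine card_bij (fun x _ => (η * x.1 * η⁻¹, η * x.2 * η⁻¹)) ?_ ?_ ?_
  · rintro ⟨p, q⟩ hx
    simpa [conj_mem_permsOfType, h, isSeparated_map_conj] using hx
  · rintro ⟨p, q⟩ _ ⟨p', q'⟩ _ hx
    simpa using hx
  · rintro ⟨p, q⟩ hx
    have hp : η * (η⁻¹ * p * η) * η⁻¹ = p := by simp [mul_assoc]
    have hq : η * (η⁻¹ * q * η) * η⁻¹ = q := by simp [mul_assoc]
    refine ⟨(η⁻¹ * p * η, η⁻¹ * q * η), ?_, by rw [hp, hq]⟩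
    rw [mem_filter, mem_product] at hx ⊢
    simp only at hx ⊢
    rw [← conj_mem_permsOfType (π := η⁻¹ * p * η) η, ← conj_mem_permsOfType (π := η⁻¹ * q * η) η,
      ← isSeparated_map_conj _ _ η, ← h (η⁻¹ * p * η) (η⁻¹ * q * η), hp, hq]
    exact hx

lemma card_sepPairs_conj (lam : n.Partition) {ζ ξ : Perm (Fin n)} (η : Perm (Fin n))
    (h : η * ζ * η⁻¹ = ξ) :
    ((permsOfType lam ×ˢ tuples n α).filter fun x => IsSeparated x.2 (x.1 * ζ)).card =
      ((permsOfType lam ×ˢ tuples n α).filter fun x => IsSeparated x.2 (x.1 * ξ)).card := by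
  subst h
  have h : ∀ p q : Perm (Fin n), η * p * η⁻¹ * (η * q * η⁻¹) = η * (p * q) * η⁻¹ := by
    intros; simp [mul_assoc]
  refine card_bij (fun x _ => (η * x.1 * η⁻¹, fun i => (x.2 i).map η.toEmbedding)) ?_ ?_ ?_
  · rintro ⟨p, A⟩ hx
    simp only [mem_filter, mem_product] at hx ⊢
    rw [conj_mem_permsOfType, map_mem_tuples, h, isSeparated_map_conj]
    exact hx
  · rintro ⟨p, A⟩ _ ⟨p', A'⟩ _ hx
    simpa [funext_iff] using hx
  · rintro ⟨p, A⟩ hx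
    have hp : η * (η⁻¹ * p * η) * η⁻¹ = p := by simp [mul_assoc]
    have hA : (fun i => ((A i).map (η⁻¹ : Perm (Fin n)).toEmbedding).map η.toEmbedding) = A := by
      ext i x
      rw [mem_map_equiv, mem_map_equiv]
      change η (η.symm x) ∈ A i ↔ _
      rw [apply_symm_apply]
    refine ⟨(η⁻¹ * p * η, fun i => (A i).map (η⁻¹ : Perm (Fin n)).toEmbedding), ?_, ?_⟩
    · simp only [mem_filter, mem_product] at hx ⊢
      rw [← conj_mem_permsOfType (π := η⁻¹ * p * η) η, ← map_mem_tuples η,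
        ← isSeparated_map_conj _ _ η, ← h (η⁻¹ * p * η) ζ, hp, hA]
      exact hx
    · simp only [hp, hA]

/-- Count triples `(π, ρ, A)` with `π * ρ` separated in two ways: the count for fixed `A` is
independent of `A`, and the count for a fixed full cycle `ρ` equals the one for `finRotate n`. -/
lemma card_tuples_mul_card_pairs (hn : 1 ≤ n) (hmn : m ≤ n) (lam : n.Partition)
    {A : Fin α.length → Finset (Fin n)} (hA : A ∈ tuples n α) :
    (tuples n α).card * ((permsOfType lam ×ˢ permsOfType (Nat.Partition.indiscrete n)).filter
      fun x => IsSeparated A (x.1 * x.2)).card =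
    (permsOfType (Nat.Partition.indiscrete n)).card * (sepPairs lam α).card := by
  rw [← smul_eq_mul, ← sum_const, sum_congr rfl fun B hB => card_pairs_eq hmn lam _ hA hB,
    ← smul_eq_mul, ← sum_const]
  have h1 : ∀ ρ ∈ permsOfType (Nat.Partition.indiscrete n), (sepPairs lam α).card =
      ((permsOfType lam ×ˢ tuples n α).filter fun x => IsSeparated x.2 (x.1 * ρ)).card := by
    intro ρ hρ
    obtain ⟨η, hη⟩ := (isFullCycle_finRotate n).exists_conj
      ((isFullCycle_iff_partition hn ρ).2 (mem_permsOfType.1 hρ))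
    rw [sepPairs]
    exact card_sepPairs_conj lam η hη
  rw [sum_congr rfl h1]
  simp only [card_filter, sum_product]
  rw [sum_comm, sum_comm (s := permsOfType (Nat.Partition.indiscrete n))]
  refine sum_congr rfl fun π _ => ?_
  rw [sum_comm]

lemma separationProb_eq (hn : 1 ≤ n) (hmn : m ≤ n) (lam : n.Partition)
    {A : Fin α.length → Finset (Fin n)} (hA : A ∈ tuples n α) :
    separationProb lam (Nat.Partition.indiscrete n) A =
      ((sepPairs lam α).card : ℚ) /
        (((n ! : ℕ) : ℚ) / ((∏ i, (α.blocksFun i)! : ℕ) * ((n - m)! : ℕ)) *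
          (permsOfType lam).card) := by
  have h1 := card_tuples_mul_card_pairs hn hmn lam hA
  have h2 : (((n ! : ℕ) : ℚ) / ((∏ i, (α.blocksFun i)! : ℕ) * ((n - m)! : ℕ))) =
      (tuples n α).card := by
    rw [div_eq_iff, ← card_tuples (α := α) hmn]
    · push_cast
      ring
    · have h3 : ∏ i, (α.blocksFun i)! ≠ 0 := prod_ne_zero_iff.2 fun i _ => Nat.factorial_ne_zero _
      exact_mod_cast mul_ne_zero h3 (Nat.factorial_ne_zero _)
  have h3 : ((tuples n α).card : ℚ) ≠ 0 := by
    exact_mod_cast (card_pos.2 ⟨A, hA⟩).ne'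
  have h4 : ((permsOfType (Nat.Partition.indiscrete n)).card : ℚ) ≠ 0 := by
    refine Nat.cast_ne_zero.2 (card_pos.2 ⟨finRotate n, ?_⟩).ne'
    rw [mem_permsOfType, ← isFullCycle_iff_partition hn]
    exact isFullCycle_finRotate n
  rw [h2, separationProb]
  have h5 : ((tuples n α).card : ℚ) *
      (((permsOfType lam ×ˢ permsOfType (Nat.Partition.indiscrete n)).filter
        fun x => IsSeparated A (x.1 * x.2)).card : ℚ) =
      (permsOfType (Nat.Partition.indiscrete n)).card * (sepPairs lam α).card := by
    exact_mod_cast h1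
  -- With a zero denominator both quotients are 0 by convention, so nonemptiness of the class is not
  -- needed.
  rcases eq_or_ne ((permsOfType lam).card : ℚ) 0 with h6 | h6
  · simp [h6]
  · rw [div_eq_div_iff (mul_ne_zero h6 h4) (mul_ne_zero h3 h6)]
    linear_combination ((permsOfType lam).card : ℚ) * h5

end Separation

end

end SeparationProb

theorem mainTheorem1 (n m : ℕ) (hn : 1 ≤ n) (hmn : m ≤ n) (α : Composition m) :
    SeparationProb.shiftT α.length (SeparationProb.genFun n α) =
      ∑ r ∈ Finset.range (n - m + 1),
        (SeparationProb.binomPoly r *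
          Polynomial.C (((n + α.length - 1).choose (n - m - r) : ℕ) : ℚ)) •
        ∑ lam : n.Partition with lam.parts.card ≤ n - α.length - r + 1,
          Polynomial.C
            (((n * (n - lam.parts.card)! * (n - α.length - r)! : ℕ) : ℚ) /
              ((n - α.length - r + 1 - lam.parts.card)! : ℕ)) •
          SeparationProb.monomialSym (Polynomial ℚ) lam
    ∧ (∀ lam : n.Partition,
        ((SeparationProb.sepPairs lam α).card : ℚ) =
          SeparationProb.powerSumCoeff lam
            (SeparationProb.evalT 1 (SeparationProb.genFun n α)))
    ∧ (∀ lam : n.Partition, ∀ A ∈ SeparationProb.tuples n α,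
        SeparationProb.separationProb lam (Nat.Partition.indiscrete n) A =
          ((SeparationProb.sepPairs lam α).card : ℚ) /
            (((n ! : ℕ) : ℚ) / ((∏ i, (α.blocksFun i)! : ℕ) * ((n - m)! : ℕ)) *
              (SeparationProb.permsOfType lam).card))
    ∧ (∀ β : Composition m, β.length = α.length →
        SeparationProb.genFun n β = SeparationProb.genFun n α) := by
  refine ⟨SeparationProb.shiftT_genFun α hn hmn, fun lam => ?_,
    fun lam A hA => SeparationProb.separationProb_eq hn hmn lam hA,
    fun β hβ => SeparationProb.genFun_eq_of_length_eq hn hmn hβ⟩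
  rw [SeparationProb.evalT_one_genFun, SeparationProb.powerSumCoeff_sum]
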